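/- Let $G$ be a finite group and let $L/K$ be a $G$-Galois extension of fields (i.e. $G$ acts faithfully on the field $L$ by automorphisms with fixed field $L^G = K$). Let $\mathrm{FP}(L)$ be the fixed-point $G$-Tambara functor of $L$, with $\mathrm{FP}(L)(G/H) = L^H$, restrictions the inclusions, and transfers and norms given by the relative traces and norms. Let $\underline{K}$ be the constant $G$-Tambara functor, i.e. the fixed-point Tambara functor of $K$ with trivial $G$-action, and let $\underline{K} \to \mathrm{FP}(L)$ be the morphism given on $G/H$ by the inclusion $K \to L^H$. Then: 1. $\underline{K} \to \mathrm{FP}(L)$ is formally étale. 2. If $\underline{K}$ satisfies the Hilbert basis theorem, then $\underline{K} \to \mathrm{FP}(L)$ is étale. Here a morphism $k \to R$ of $G$-Tambara functors is *formally étale* if $R$ is flat as a $k$-module (i.e. the functor $R \boxtimes_k -$ is exact on $k$-modules) and its genuine Kähler differentials $\Omega^{1,\mathrm{Tamb}}_{R/k} = I/I^{>1}$ vanish, where $I$ is the kernel of the multiplication $R \boxtimes_k R \to R$ and $I^{>1}$ is the Tambara ideal generated by all products of two elements of $I$ and all norms of elements of $I$ along maps $G/J \to G/H$ with $J$ conjugate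 to a proper subgroup of $H$. It is *étale* if it is formally étale and finitely presented, i.e. $R$ is isomorphic to a coequalizer of two maps between free polynomial $k$-algebras on finitely many generators (each generator living in the level of some finite $G$-set; the free polynomial $k$-algebra on a generator in level $X$ represents the functor $S \mapsto S(X)$ on $k$-algebras). Finally, $k$ *satisfies the Hilbert basis theorem* if every Tambara ideal of every free polynomial $k$-algebra on finitely many generators is finitely generated. -/

import Mathlib

universe u

namespace Tambara

/-! ### Finite `G`-sets -/

/-- A finite `G`-set, with underlying set `{0, …, card - 1}`.  Together with equivariant maps these
form a small category equivalent to that of all finite `G`-sets (see `FinGSet.exists_model`). -/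
structure FinGSet (G : Type u) [Group G] : Type u where
  card : ℕ
  act : MulAction G (Fin card)

namespace FinGSet

variable {G : Type u} [Group G]

/-- The underlying set. -/
def carrier (X : FinGSet G) : Type := Fin X.card

instance : CoeSort (FinGSet G) Type := ⟨carrier⟩

instance (X : FinGSet G) : Fintype X := inferInstanceAs (Fintype (Fin X.card))

instance (X : FinGSet G) : DecidableEq X := inferInstanceAs (DecidableEq (Fin X.card))

instance (X : FinGSet G) : MulAction G X := X.act

/-- Every finite `G`-set is equivariantly in bijection with one of our models. -/
theorem exists_model (S : Type*) [Finite S] [MulAction G S] :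
    ∃ (X : FinGSet G) (e : S ≃ X), ∀ (g : G) (s : S), e (g • s) = g • e s := by
  obtain ⟨n, ⟨e⟩⟩ := Finite.exists_equiv_fin S
  refine ⟨⟨n, e.symm.mulAction G⟩, e, fun g s => ?_⟩
  change e (g • s) = e (g • e.symm (e s))
  rw [e.symm_apply_apply]

/-- `X` is an orbit, i.e. isomorphic to some `G/H`. -/
def IsOrbit (X : FinGSet G) : Prop := Nonempty X ∧ MulAction.IsPretransitive G X

/-- `i` and `j` exhibit `Z` as the disjoint union of `X` and `Y`. -/
def IsCoprod {X Y Z : FinGSet G} (i : X →[G] Z) (j : Y →[G] Z) : Prop :=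
  Function.Bijective (Sum.elim (i : X → Z) (j : Y → Z))

/-- The square with top `g' : W → X`, left side `f' : W → Y'`, right side `f : X → Y` and bottom
`g : Y' → Y` commutes and is cartesian. -/
structure IsCartesian {W X Y' Y : FinGSet G} (g' : W →[G] X) (f' : W →[G] Y')
    (f : X →[G] Y) (g : Y' →[G] Y) : Prop where
  comm : ∀ w, f (g' w) = g (f' w)
  lift : ∀ x y', f x = g y' → ∃! w, g' w = x ∧ f' w = y'

/-- An exponential diagram over `A --p--> X --f--> Y`.  Here `q : B → Y` is (isomorphic to) the
dependent product of `p` along `f`, whose fibre over `y` is the set of sections of `p` over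
`f⁻¹(y)`; the set `W` is the pullback `X ×_Y B`, with projections `p ∘ e` and `f'`, and
`e : W → A` is evaluation of sections. -/
structure IsExponential {A X Y W B : FinGSet G} (p : A →[G] X) (f : X →[G] Y)
    (e : W →[G] A) (f' : W →[G] B) (q : B →[G] Y) : Prop where
  cartesian : IsCartesian (p.comp e) f' f q
  sections : ∀ (y : Y) (s : {x : X // f x = y} → A), (∀ x, p (s x) = x.1) →
    ∃! b : B, q b = y ∧ ∀ w, f' w = b → ∃ h : f (p (e w)) = y, s ⟨p (e w), h⟩ = e w

end FinGSet

open FinGSet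

/-! ### Tambara functors and their morphisms -/

/-- A `G`-Tambara functor: commutative rings `T(X)` for finite `G`-sets `X`, with restrictions
`f^*`, transfers `f_+` and norms `f_!` along maps `f` of finite `G`-sets. -/
structure TambaraFunctor (G : Type u) [Group G] where
  obj : FinGSet G → Type u
  [ring : ∀ X, CommRing (obj X)]
  res : ∀ {X Y : FinGSet G}, (X →[G] Y) → (obj Y →+* obj X)
  tr : ∀ {X Y : FinGSet G}, (X →[G] Y) → (obj X →+ obj Y)
  nm : ∀ {X Y : FinGSet G}, (X →[G] Y) → (obj X →* obj Y)
  res_id : ∀ (X : FinGSet G) (a : obj X), res (MulActionHom.id G) a = a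
  tr_id : ∀ (X : FinGSet G) (a : obj X), tr (MulActionHom.id G) a = a
  nm_id : ∀ (X : FinGSet G) (a : obj X), nm (MulActionHom.id G) a = a
  res_comp : ∀ {X Y Z : FinGSet G} (g : Y →[G] Z) (f : X →[G] Y) (a : obj Z),
    res (g.comp f) a = res f (res g a)
  tr_comp : ∀ {X Y Z : FinGSet G} (g : Y →[G] Z) (f : X →[G] Y) (a : obj X),
    tr (g.comp f) a = tr g (tr f a)
  nm_comp : ∀ {X Y Z : FinGSet G} (g : Y →[G] Z) (f : X →[G] Y) (a : obj X),
    nm (g.comp f) a = nm g (nm f a)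
  /-- Base change (double coset formula) for transfers. -/
  res_tr : ∀ {W X Y' Y : FinGSet G} {g' : W →[G] X} {f' : W →[G] Y'} {f : X →[G] Y}
    {g : Y' →[G] Y}, IsCartesian g' f' f g → ∀ a : obj X, res g (tr f a) = tr f' (res g' a)
  /-- Base change (double coset formula) for norms. -/
  res_nm : ∀ {W X Y' Y : FinGSet G} {g' : W →[G] X} {f' : W →[G] Y'} {f : X →[G] Y}
    {g : Y' →[G] Y}, IsCartesian g' f' f g → ∀ a : obj X, res g (nm f a) = nm f' (res g' a)
  /-- Distributivity of norms over transfers. -/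
  nm_tr : ∀ {A X Y W B : FinGSet G} {p : A →[G] X} {f : X →[G] Y} {e : W →[G] A}
    {f' : W →[G] B} {q : B →[G] Y}, IsExponential p f e f' q →
    ∀ a : obj A, nm f (tr p a) = tr q (nm f' (res e a))
  /-- Frobenius reciprocity.  (It also follows from distributivity for fold maps.) -/
  tr_mul_res : ∀ {X Y : FinGSet G} (f : X →[G] Y) (a : obj X) (b : obj Y),
    tr f (a * res f b) = tr f a * b
  /-- `T` takes disjoint unions to products. -/
  additive : ∀ {X Y Z : FinGSet G} (i : X →[G] Z) (j : Y →[G] Z), IsCoprod i j →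
    Function.Bijective (fun a : obj Z => (res i a, res j a))
  additive_empty : ∀ X : FinGSet G, IsEmpty X → Subsingleton (obj X)

attribute [instance] TambaraFunctor.ring

variable {G : Type u} [Group G]

/-- A morphism of Tambara functors.  A morphism `k → R` is the same as a `k`-algebra `R`. -/
@[ext]
structure TambaraHom (R S : TambaraFunctor G) where
  app : ∀ X : FinGSet G, R.obj X →+* S.obj X
  app_res : ∀ {X Y : FinGSet G} (f : X →[G] Y) (a : R.obj Y),
    app X (R.res f a) = S.res f (app Y a)
  app_tr : ∀ {X Y : FinGSet G} (f : X →[G] Y) (a : R.obj X),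
    app Y (R.tr f a) = S.tr f (app X a)
  app_nm : ∀ {X Y : FinGSet G} (f : X →[G] Y) (a : R.obj X),
    app Y (R.nm f a) = S.nm f (app X a)

namespace TambaraHom

/-- The identity morphism. -/
def id (R : TambaraFunctor G) : TambaraHom R R where
  app X := RingHom.id (R.obj X)
  app_res _ _ := rfl
  app_tr _ _ := rfl
  app_nm _ _ := rfl

/-- The composite `R → S → T`. -/
def comp {R S T : TambaraFunctor G} (ψ : TambaraHom S T) (φ : TambaraHom R S) :
    TambaraHom R T where
  app X := (ψ.app X).comp (φ.app X)
  app_res f a := by simp [φ.app_res, ψ.app_res]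
  app_tr f a := by simp [φ.app_tr, ψ.app_tr]
  app_nm f a := by simp [φ.app_nm, ψ.app_nm]

end TambaraHom

/-! ### Tambara ideals -/

/-- An ideal of a Tambara functor: ideals `I(X) ⊆ T(X)` stable under restrictions and transfers and
such that `f_!(I(X)) ⊆ f_!(0) + I(Y)`. -/
@[ext]
structure TambaraIdeal (T : TambaraFunctor G) where
  carrier : ∀ X : FinGSet G, Ideal (T.obj X)
  res_mem : ∀ {X Y : FinGSet G} (f : X →[G] Y) (a : T.obj Y),
    a ∈ carrier Y → T.res f a ∈ carrier X
  tr_mem : ∀ {X Y : FinGSet G} (f : X →[G] Y) (a : T.obj X),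
    a ∈ carrier X → T.tr f a ∈ carrier Y
  nm_mem : ∀ {X Y : FinGSet G} (f : X →[G] Y) (a : T.obj X),
    a ∈ carrier X → T.nm f a - T.nm f 0 ∈ carrier Y

namespace TambaraIdeal

variable {T : TambaraFunctor G}

/-- The ideal generated by a set of elements at various levels: the intersection of all ideals
containing it. -/
def span (S : Set (Σ X : FinGSet G, T.obj X)) : TambaraIdeal T where
  carrier X := ⨅ I : {I : TambaraIdeal T // ∀ s ∈ S, s.2 ∈ I.carrier s.1}, I.1.carrier X
  res_mem f a ha := by
    simp only [Submodule.mem_iInf] at ha ⊢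
    exact fun I => I.1.res_mem f a (ha I)
  tr_mem f a ha := by
    simp only [Submodule.mem_iInf] at ha ⊢
    exact fun I => I.1.tr_mem f a (ha I)
  nm_mem f a ha := by
    simp only [Submodule.mem_iInf] at ha ⊢
    exact fun I => I.1.nm_mem f a (ha I)

/-- The ideal is generated by finitely many elements. -/
def FG (I : TambaraIdeal T) : Prop :=
  ∃ S : Set (Σ X : FinGSet G, T.obj X), S.Finite ∧ span S = I

/-- The kernel of a morphism of Tambara functors. -/
def ker {R S : TambaraFunctor G} (φ : TambaraHom R S) : TambaraIdeal R where
  carrier X := RingHom.ker (φ.app X)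
  res_mem f a ha := by
    rw [RingHom.mem_ker] at ha ⊢
    rw [φ.app_res, ha, map_zero]
  tr_mem f a ha := by
    rw [RingHom.mem_ker] at ha ⊢
    rw [φ.app_tr, ha, map_zero]
  nm_mem f a ha := by
    rw [RingHom.mem_ker] at ha ⊢
    rw [map_sub, φ.app_nm, φ.app_nm, ha, map_zero (φ.app _), sub_self]

/-- The ideal `I^{>1}` generated by all products of two elements of `I` and all norms of elements of
`I` along non-injective maps of orbits, i.e. along maps `G/K → G/H` with `K` conjugate to a proper
subgroup of `H`. -/
def gtOne (I : TambaraIdeal T) : TambaraIdeal T :=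
  span ({s | ∃ (X : FinGSet G) (a b : T.obj X),
      a ∈ I.carrier X ∧ b ∈ I.carrier X ∧ s = ⟨X, a * b⟩} ∪
    {s | ∃ (X Y : FinGSet G) (f : X →[G] Y) (a : T.obj X), X.IsOrbit ∧ Y.IsOrbit ∧
      ¬ Function.Injective f ∧ a ∈ I.carrier X ∧ s = ⟨Y, T.nm f a⟩})

/-- The quotient `I / I^{>1}` at level `X`. -/
abbrev Cotangent (I : TambaraIdeal T) (X : FinGSet G) : Type u :=
  (I.carrier X) ⧸ Submodule.comap (Submodule.subtype (I.carrier X)) (I.gtOne.carrier X)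

end TambaraIdeal

/-! ### Modules over (the underlying Green functor of) a Tambara functor -/

/-- A `k`-module: a Mackey functor `M` with `k(X)`-module structures on `M(X)` that are compatible
with restrictions and satisfy Frobenius reciprocity. -/
structure Mod (k : TambaraFunctor G) where
  obj : FinGSet G → Type u
  [addCommGroup : ∀ X, AddCommGroup (obj X)]
  [module : ∀ X, Module (k.obj X) (obj X)]
  res : ∀ {X Y : FinGSet G}, (X →[G] Y) → (obj Y →+ obj X)
  tr : ∀ {X Y : FinGSet G}, (X →[G] Y) → (obj X →+ obj Y)
  res_id : ∀ (X : FinGSet G) (m : obj X), res (MulActionHom.id G) m = m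
  tr_id : ∀ (X : FinGSet G) (m : obj X), tr (MulActionHom.id G) m = m
  res_comp : ∀ {X Y Z : FinGSet G} (g : Y →[G] Z) (f : X →[G] Y) (m : obj Z),
    res (g.comp f) m = res f (res g m)
  tr_comp : ∀ {X Y Z : FinGSet G} (g : Y →[G] Z) (f : X →[G] Y) (m : obj X),
    tr (g.comp f) m = tr g (tr f m)
  res_tr : ∀ {W X Y' Y : FinGSet G} {g' : W →[G] X} {f' : W →[G] Y'} {f : X →[G] Y}
    {g : Y' →[G] Y}, IsCartesian g' f' f g → ∀ m : obj X, res g (tr f m) = tr f' (res g' m)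
  additive : ∀ {X Y Z : FinGSet G} (i : X →[G] Z) (j : Y →[G] Z), IsCoprod i j →
    Function.Bijective (fun m : obj Z => (res i m, res j m))
  additive_empty : ∀ X : FinGSet G, IsEmpty X → Subsingleton (obj X)
  res_smul : ∀ {X Y : FinGSet G} (f : X →[G] Y) (a : k.obj Y) (m : obj Y),
    res f (a • m) = k.res f a • res f m
  tr_res_smul : ∀ {X Y : FinGSet G} (f : X →[G] Y) (a : k.obj Y) (m : obj X),
    tr f (k.res f a • m) = a • tr f m
  tr_smul_res : ∀ {X Y : FinGSet G} (f : X →[G] Y) (a : k.obj X) (m : obj Y),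
    tr f (a • res f m) = k.tr f a • m

attribute [instance] Mod.addCommGroup Mod.module

/-- A morphism of `k`-modules. -/
structure ModHom {k : TambaraFunctor G} (M N : Mod k) where
  app : ∀ X : FinGSet G, M.obj X →ₗ[k.obj X] N.obj X
  app_res : ∀ {X Y : FinGSet G} (f : X →[G] Y) (m : M.obj Y),
    app X (M.res f m) = N.res f (app Y m)
  app_tr : ∀ {X Y : FinGSet G} (f : X →[G] Y) (m : M.obj X),
    app Y (M.tr f m) = N.tr f (app X m)

/-- A `k`-algebra, regarded as a `k`-module. -/
def TambaraHom.toMod {k R : TambaraFunctor G} (φ : TambaraHom k R) : Mod k where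
  obj := R.obj
  module X := (φ.app X).toModule
  res f := (R.res f).toAddMonoidHom
  tr f := R.tr f
  res_id := R.res_id
  tr_id := R.tr_id
  res_comp := R.res_comp
  tr_comp := R.tr_comp
  res_tr := R.res_tr
  additive := R.additive
  additive_empty := R.additive_empty
  res_smul {X Y} f a m := by
    change R.res f (φ.app Y a * m) = φ.app X (k.res f a) * R.res f m
    rw [map_mul, φ.app_res]
  tr_res_smul {X Y} f a m := by
    change R.tr f (φ.app X (k.res f a) * m) = φ.app Y a * R.tr f m
    rw [φ.app_res, mul_comm, R.tr_mul_res, mul_comm]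
  tr_smul_res {X Y} f a m := by
    change R.tr f (φ.app X a * R.res f m) = φ.app Y (k.tr f a) * m
    rw [R.tr_mul_res, φ.app_tr]

/-! ### The box product over `k`, flatness -/

/-- The symbol `[f : A → X, m ⊗ n]` for a finite `G`-set `A` over `X`, `m ∈ M(A)`, `n ∈ N(A)`. -/
structure BoxSymbol {k : TambaraFunctor G} (M N : Mod k) (X : FinGSet G) : Type u where
  A : FinGSet G
  f : A →[G] X
  m : M.obj A
  n : N.obj A

/-- The defining relations of the box product over `k`: the symbols are additive in `m` and in `n`
and `k(A)`-balanced, and satisfy Frobenius reciprocity. -/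
inductive BoxRel {k : TambaraFunctor G} (M N : Mod k) (X : FinGSet G) :
    FreeAbelianGroup (BoxSymbol M N X) → Prop
  | add_left (A : FinGSet G) (f : A →[G] X) (m m' : M.obj A) (n : N.obj A) :
      BoxRel M N X (.of ⟨A, f, m + m', n⟩ - .of ⟨A, f, m, n⟩ - .of ⟨A, f, m', n⟩)
  | add_right (A : FinGSet G) (f : A →[G] X) (m : M.obj A) (n n' : N.obj A) :
      BoxRel M N X (.of ⟨A, f, m, n + n'⟩ - .of ⟨A, f, m, n⟩ - .of ⟨A, f, m, n'⟩)
  | balanced (A : FinGSet G) (f : A →[G] X) (c : k.obj A) (m : M.obj A) (n : N.obj A) :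
      BoxRel M N X (.of ⟨A, f, c • m, n⟩ - .of ⟨A, f, m, c • n⟩)
  | tr_left (A B : FinGSet G) (g : A →[G] B) (f : B →[G] X) (m : M.obj A) (n : N.obj B) :
      BoxRel M N X (.of ⟨B, f, M.tr g m, n⟩ - .of ⟨A, f.comp g, m, N.res g n⟩)
  | tr_right (A B : FinGSet G) (g : A →[G] B) (f : B →[G] X) (m : M.obj B) (n : N.obj A) :
      BoxRel M N X (.of ⟨B, f, m, N.tr g n⟩ - .of ⟨A, f.comp g, M.res g m, n⟩)

/-- The relative box product `(M ⊠_k N)(X)` at level `X`. -/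
abbrev Box {k : TambaraFunctor G} (M N : Mod k) (X : FinGSet G) : Type u :=
  FreeAbelianGroup (BoxSymbol M N X) ⧸ AddSubgroup.closure {r | BoxRel M N X r}

namespace Box

/-- The class of a symbol in the box product. -/
def mk {k : TambaraFunctor G} (M N : Mod k) {X A : FinGSet G} (f : A →[G] X) (m : M.obj A)
    (n : N.obj A) : Box M N X :=
  QuotientAddGroup.mk (FreeAbelianGroup.of ⟨A, f, m, n⟩)

/-- The map `M ⊠_k N → M ⊠_k N'`, `[f, m ⊗ n] ↦ [f, m ⊗ i(n)]`, at level `X`. -/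
def map {k : TambaraFunctor G} (M : Mod k) {N N' : Mod k} (i : ModHom N N') (X : FinGSet G) :
    Box M N X →+ Box M N' X :=
  QuotientAddGroup.lift _
    (FreeAbelianGroup.lift fun s : BoxSymbol M N X => mk M N' s.f s.m (i.app s.A s.n)) <| by
    have key : ∀ r, BoxRel M N' X r → (QuotientAddGroup.mk r : Box M N' X) = 0 := fun r hr =>
      (QuotientAddGroup.eq_zero_iff r).2 (AddSubgroup.subset_closure hr)
    rw [AddSubgroup.closure_le]
    rintro r hr
    simp only [SetLike.mem_coe, AddMonoidHom.mem_ker]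
    cases hr with
    | add_left A f m m' n =>
      simpa [mk] using key _ (.add_left A f m m' (i.app A n))
    | add_right A f m n n' =>
      simpa [mk] using key _ (.add_right A f m (i.app A n) (i.app A n'))
    | balanced A f c m n =>
      simpa [mk] using key _ (.balanced A f c m (i.app A n))
    | tr_left A B g f m n =>
      simpa [mk, i.app_res] using key _ (.tr_left A B g f m (i.app B n))
    | tr_right A B g f m n =>
      simpa [mk, i.app_tr] using key _ (.tr_right A B g f m (i.app A n))

/-- For a `k`-algebra `R` and two maps of `k`-algebras `i, j : R → P`, the induced map
`R ⊠_k R → P`, `[f, r ⊗ s] ↦ f_+(i(r) j(s))`, at level `X`. -/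
def toAlg {k R P : TambaraFunctor G} (φ : TambaraHom k R) (i j : TambaraHom R P)
    (h : i.comp φ = j.comp φ) (X : FinGSet G) : Box φ.toMod φ.toMod X →+ P.obj X :=
  QuotientAddGroup.lift _
    (FreeAbelianGroup.lift fun s : BoxSymbol φ.toMod φ.toMod X =>
      P.tr s.f (i.app s.A s.m * j.app s.A s.n)) <| by
    rw [AddSubgroup.closure_le]
    rintro r hr
    simp only [SetLike.mem_coe, AddMonoidHom.mem_ker]
    cases hr with
    | add_left A f m m' n =>
      have : i.app A (m + m') = i.app A m + i.app A m' := map_add (i.app A) _ _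
      simp [this, add_mul]
    | add_right A f m n n' =>
      have : j.app A (n + n') = j.app A n + j.app A n' := map_add (j.app A) _ _
      simp [this, mul_add]
    | balanced A f c m n =>
      have h1 : i.app A (c • m) = i.app A (φ.app A c) * i.app A m := map_mul (i.app A) _ _
      have h2 : j.app A (c • n) = j.app A (φ.app A c) * j.app A n := map_mul (j.app A) _ _
      have h3 : i.app A (φ.app A c) = j.app A (φ.app A c) :=
        congrArg (fun t : TambaraHom k P => t.app A c) h
      simp only [map_sub, FreeAbelianGroup.lift_apply_of, h1, h2, h3]
      rw [sub_eq_zero]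
      congr 1
      ring
    | tr_left A B g f m n =>
      have h1 : i.app B (φ.toMod.tr g m) = P.tr g (i.app A m) := i.app_tr g m
      have h2 : j.app A (φ.toMod.res g n) = P.res g (j.app B n) := j.app_res g n
      simp only [map_sub, FreeAbelianGroup.lift_apply_of, h1, h2, P.tr_comp, P.tr_mul_res,
        sub_self]
    | tr_right A B g f m n =>
      have h1 : j.app B (φ.toMod.tr g n) = P.tr g (j.app A n) := j.app_tr g n
      have h2 : i.app A (φ.toMod.res g m) = P.res g (i.app B m) := i.app_res g m
      simp only [map_sub, FreeAbelianGroup.lift_apply_of, h1, h2, P.tr_comp]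
      rw [mul_comm (P.res g _), P.tr_mul_res, mul_comm, sub_self]

end Box

/-- A short exact sequence `0 → N₁ → N₂ → N₃ → 0` of `k`-modules (exactness is levelwise). -/
def IsShortExact {k : TambaraFunctor G} {N₁ N₂ N₃ : Mod k} (i : ModHom N₁ N₂)
    (p : ModHom N₂ N₃) : Prop :=
  ∀ X : FinGSet G, Function.Injective (i.app X) ∧ Function.Exact (i.app X) (p.app X) ∧
    Function.Surjective (p.app X)

/-- `M` is flat: `M ⊠_k -` takes short exact sequences of `k`-modules to short exact sequences. -/
def IsFlat {k : TambaraFunctor G} (M : Mod k) : Prop :=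
  ∀ (N₁ N₂ N₃ : Mod k) (i : ModHom N₁ N₂) (p : ModHom N₂ N₃), IsShortExact i p →
    ∀ X : FinGSet G, Function.Injective (Box.map M i X) ∧
      Function.Exact (Box.map M i X) (Box.map M p X) ∧ Function.Surjective (Box.map M p X)

/-! ### Genuine Kähler differentials, étale morphisms -/

/-- The Tambara functor `R ⊠_k R` with its multiplication map to `R`, for a `k`-algebra `R`.

Here `P` is a Tambara functor whose underlying Mackey functor is the box product `R ⊠_k R`, in such
a way that `r ↦ r ⊗ 1` and `s ↦ 1 ⊗ s` are maps of Tambara functors and that transfers and products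
are those of the box product.  The norms of `P` are then determined by distributivity, and `mult` is
determined by `r ⊗ s ↦ r s`; so all of these data are unique up to unique isomorphism. -/
structure BoxSquare {k R : TambaraFunctor G} (φ : TambaraHom k R) where
  P : TambaraFunctor G
  inl : TambaraHom R P
  inr : TambaraHom R P
  comm : inl.comp φ = inr.comp φ
  isBox : ∀ X : FinGSet G, Function.Bijective (Box.toAlg φ inl inr comm X)
  mult : TambaraHom P R
  mult_inl : mult.comp inl = TambaraHom.id R
  mult_inr : mult.comp inr = TambaraHom.id R

/-- The genuine Kähler differentials `Ω = I / I^{>1}`, for `I` the kernel of `R ⊠_k R → R`, at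
level `X`. -/
abbrev BoxSquare.Kaehler {k R : TambaraFunctor G} {φ : TambaraHom k R} (B : BoxSquare φ)
    (X : FinGSet G) : Type u :=
  (TambaraIdeal.ker B.mult).Cotangent X

/-- The genuine Kähler differentials of `k → R` vanish. -/
def KaehlerVanishes {k R : TambaraFunctor G} (φ : TambaraHom k R) : Prop :=
  ∃ B : BoxSquare φ, ∀ X : FinGSet G, Subsingleton (B.Kaehler X)

/-- `k → R` is formally étale. -/
def IsFormallyEtale {k R : TambaraFunctor G} (φ : TambaraHom k R) : Prop :=
  KaehlerVanishes φ ∧ IsFlat φ.toMod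

/-- The `k`-algebra `P` with elements `y i ∈ P(X i)` is the free polynomial `k`-algebra on
generators `y i` in levels `X i`: it represents `S ↦ ∏ i, S(X i)` on `k`-algebras. -/
def IsFreePolynomial {k P : TambaraFunctor G} (ψ : TambaraHom k P) {n : ℕ}
    (X : Fin n → FinGSet G) (y : ∀ i, P.obj (X i)) : Prop :=
  ∀ (S : TambaraFunctor G) (σ : TambaraHom k S) (s : ∀ i, S.obj (X i)),
    ∃! t : TambaraHom P S, t.comp ψ = σ ∧ ∀ i, t.app (X i) (y i) = s i

/-- The `k`-algebra `P` is a free polynomial `k`-algebra on finitely many generators. -/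
def IsFinFreePolynomial {k P : TambaraFunctor G} (ψ : TambaraHom k P) : Prop :=
  ∃ (n : ℕ) (X : Fin n → FinGSet G) (y : ∀ i, P.obj (X i)), IsFreePolynomial ψ X y

/-- `q : P → R` is a coequalizer of `a, b : Q → P`.  (If `a` and `b` are maps of `k`-algebras, this is
the same in Tambara functors and in `k`-algebras, as a map out of the `k`-algebra `P` determines the
`k`-algebra structure of its target.) -/
def IsCoequalizer {Q P R : TambaraFunctor G} (a b : TambaraHom Q P) (q : TambaraHom P R) : Prop :=
  q.comp a = q.comp b ∧
    ∀ (S : TambaraFunctor G) (t : TambaraHom P S), t.comp a = t.comp b →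
      ∃! v : TambaraHom R S, v.comp q = t

/-- The `k`-algebra `R` is finitely presented: it is a coequalizer of two maps between free
polynomial `k`-algebras on finitely many generators. -/
def IsFinitelyPresented {k R : TambaraFunctor G} (φ : TambaraHom k R) : Prop :=
  ∃ (Q P : TambaraFunctor G) (ξ : TambaraHom k Q) (ψ : TambaraHom k P)
    (a b : TambaraHom Q P) (q : TambaraHom P R),
    IsFinFreePolynomial ξ ∧ IsFinFreePolynomial ψ ∧ a.comp ξ = ψ ∧ b.comp ξ = ψ ∧
      q.comp ψ = φ ∧ IsCoequalizer a b q

/-- `k → R` is étale. -/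
def IsEtale {k R : TambaraFunctor G} (φ : TambaraHom k R) : Prop :=
  IsFormallyEtale φ ∧ IsFinitelyPresented φ

/-- `k` satisfies the Hilbert basis theorem: every ideal of every free polynomial `k`-algebra on
finitely many generators is finitely generated. -/
def SatisfiesHilbertBasis (k : TambaraFunctor G) : Prop :=
  ∀ (P : TambaraFunctor G) (ψ : TambaraHom k P), IsFinFreePolynomial ψ →
    ∀ I : TambaraIdeal P, I.FG

/-! ### Fixed-point and constant Tambara functors -/

section FixedPoints

variable (G) (A : Type u) [CommRing A] [MulSemiringAction G A]

/-- The ring of equivariant functions `X → A`; for `X = G/H` it is `A^H`. -/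
def equivariantFunctions (X : FinGSet G) : Subring (X → A) where
  carrier := {φ | ∀ (g : G) (x : X), φ (g • x) = g • φ x}
  mul_mem' ha hb g x := by simp [ha g x, hb g x, smul_mul']
  one_mem' g x := by simp
  add_mem' ha hb g x := by simp [ha g x, hb g x]
  zero_mem' g x := by simp
  neg_mem' ha g x := by simp [ha g x]

variable {G A}

/-- Translation by `g` as a bijection from the fibre over `y` to the fibre over `g • y`. -/
def fibreSMul {X Y : FinGSet G} (f : X →[G] Y) (g : G) (y : Y) :
    {x : X // f x = y} ≃ {x : X // f x = g • y} where
  toFun x := ⟨g • x.1, by rw [map_smul, x.2]⟩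
  invFun x := ⟨g⁻¹ • x.1, by rw [map_smul, x.2, inv_smul_smul]⟩
  left_inv x := by simp
  right_inv x := by simp

/-- For a cartesian square, the fibre of `f'` over `y` is the fibre of `f` over `g y`. -/
theorem fibre_bijective {W X Y' Y : FinGSet G} {g' : W →[G] X} {f' : W →[G] Y'} {f : X →[G] Y}
    {g : Y' →[G] Y} (h : IsCartesian g' f' f g) (y : Y') :
    Function.Bijective (fun w : {w : W // f' w = y} =>
      (⟨g' w.1, by rw [h.comm, w.2]⟩ : {x : X // f x = g y})) := by
  constructor
  · rintro ⟨w, hw⟩ ⟨w', hw'⟩ e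
    simp only [Subtype.mk.injEq] at e ⊢
    obtain ⟨v, -, hv⟩ := h.lift (g' w) y (by rw [h.comm, hw])
    rw [hv w ⟨rfl, hw⟩, hv w' ⟨e.symm, hw'⟩]
  · rintro ⟨x, hx⟩
    obtain ⟨w, ⟨h1, h2⟩, -⟩ := h.lift x y hx
    exact ⟨⟨w, h2⟩, by simp [h1]⟩

/-- Restriction: precomposition with `f`. -/
def FP.res {X Y : FinGSet G} (f : X →[G] Y) :
    equivariantFunctions G A Y →+* equivariantFunctions G A X where
  toFun φ := ⟨fun x => φ.1 (f x), fun g x => by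
    change φ.1 (f (g • x)) = g • φ.1 (f x)
    rw [map_smul, φ.2]⟩
  map_one' := rfl
  map_mul' _ _ := rfl
  map_zero' := rfl
  map_add' _ _ := rfl

/-- Transfer: sum over the fibres of `f`. -/
def FP.tr {X Y : FinGSet G} (f : X →[G] Y) :
    equivariantFunctions G A X →+ equivariantFunctions G A Y where
  toFun φ := ⟨fun y => ∑ x : {x : X // f x = y}, φ.1 x.1, fun g y => by
    change ∑ x : {x : X // f x = g • y}, φ.1 x.1 = g • ∑ x : {x : X // f x = y}, φ.1 x.1
    rw [Finset.smul_sum, ← (fibreSMul f g y).sum_comp]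
    exact Finset.sum_congr rfl fun x _ => φ.2 g x.1⟩
  map_zero' := by ext y; simp
  map_add' φ ψ := by ext y; simp [Finset.sum_add_distrib]

/-- Norm: product over the fibres of `f`. -/
def FP.nm {X Y : FinGSet G} (f : X →[G] Y) :
    equivariantFunctions G A X →* equivariantFunctions G A Y where
  toFun φ := ⟨fun y => ∏ x : {x : X // f x = y}, φ.1 x.1, fun g y => by
    change ∏ x : {x : X // f x = g • y}, φ.1 x.1 = g • ∏ x : {x : X // f x = y}, φ.1 x.1
    rw [Finset.smul_prod', ← (fibreSMul f g y).prod_comp]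
    exact Finset.prod_congr rfl fun x _ => φ.2 g x.1⟩
  map_one' := by ext y; simp
  map_mul' φ ψ := by ext y; simp [Finset.prod_mul_distrib]

theorem FP.tr_apply {X Y : FinGSet G} (f : X →[G] Y) (φ : equivariantFunctions G A X) (y : Y) :
    (FP.tr f φ).1 y = ∑ x : {x : X // f x = y}, φ.1 x.1 := rfl

theorem FP.nm_apply {X Y : FinGSet G} (f : X →[G] Y) (φ : equivariantFunctions G A X) (y : Y) :
    (FP.nm f φ).1 y = ∏ x : {x : X // f x = y}, φ.1 x.1 := rfl

variable (G A)

/-- The fixed-point Tambara functor `FP(A)` of a commutative ring `A` with `G`-action: its value on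
`X` is the ring of equivariant functions `X → A`, so that `FP(A)(G/H) = A^H`. -/
def FP : TambaraFunctor G where
  obj X := equivariantFunctions G A X
  res := FP.res
  tr := FP.tr
  nm := FP.nm
  res_id X a := rfl
  tr_id X a := by
    ext y
    rw [FP.tr_apply]
    exact Finset.sum_eq_single (⟨y, rfl⟩ : {x : X // MulActionHom.id G x = y})
      (fun x _ hx => absurd (Subtype.ext x.2) hx) (fun h => absurd (@Finset.mem_univ _ (_) _) h)
  nm_id X a := by
    ext y
    rw [FP.nm_apply]
    exact Finset.prod_eq_single (⟨y, rfl⟩ : {x : X // MulActionHom.id G x = y})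
      (fun x _ hx => absurd (Subtype.ext x.2) hx) (fun h => absurd (@Finset.mem_univ _ (_) _) h)
  res_comp g f a := rfl
  tr_comp {X Y Z} g f a := by
    ext z
    change ∑ x : {x : X // g (f x) = z}, a.1 x.1 =
      ∑ y : {y : Y // g y = z}, ∑ x : {x : X // f x = y.1}, a.1 x.1
    rw [← Fintype.sum_sigma']
    exact Fintype.sum_equiv
      { toFun := fun x => ⟨⟨f x.1, x.2⟩, ⟨x.1, rfl⟩⟩
        invFun := fun s => ⟨s.2.1, (congrArg g s.2.2).trans s.1.2⟩
        left_inv := fun x => rfl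
        right_inv := fun s => by
          obtain ⟨⟨y, hy⟩, ⟨x, hx⟩⟩ := s
          change f x = y at hx
          subst hx
          rfl } _ _ (fun x => rfl)
  nm_comp {X Y Z} g f a := by
    ext z
    change ∏ x : {x : X // g (f x) = z}, a.1 x.1 =
      ∏ y : {y : Y // g y = z}, ∏ x : {x : X // f x = y.1}, a.1 x.1
    rw [← Fintype.prod_sigma']
    exact Fintype.prod_equiv
      { toFun := fun x => ⟨⟨f x.1, x.2⟩, ⟨x.1, rfl⟩⟩
        invFun := fun s => ⟨s.2.1, (congrArg g s.2.2).trans s.1.2⟩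
        left_inv := fun x => rfl
        right_inv := fun s => by
          obtain ⟨⟨y, hy⟩, ⟨x, hx⟩⟩ := s
          change f x = y at hx
          subst hx
          rfl } _ _ (fun x => rfl)
  res_tr h a := by
    ext y
    exact (Fintype.sum_bijective _ (fibre_bijective h y) _ _ (fun w => rfl)).symm
  res_nm h a := by
    ext y
    exact (Fintype.prod_bijective _ (fibre_bijective h y) _ _ (fun w => rfl)).symm
  nm_tr {S X Y W B} p f e f' q h a := by
    classical
    ext y
    change ∏ x : {x : X // f x = y}, ∑ s : {s : S // p s = x.1}, a.1 s.1 =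
      ∑ b : {b : B // q b = y}, ∏ w : {w : W // f' w = b.1}, a.1 (e w.1)
    rw [Finset.prod_univ_sum, Fintype.piFinset_univ]
    have hq : ∀ (b : {b : B // q b = y}) (x : {x : X // f x = y}),
        ∃! w, p (e w) = x.1 ∧ f' w = b.1 := fun b x =>
      h.cartesian.lift x.1 b.1 (by rw [x.2, b.2])
    choose w hw hu using hq
    symm
    refine Fintype.sum_bijective
      (fun b (x : {x : X // f x = y}) =>
        (⟨e (w b x), (hw b x).1⟩ : {s : S // p s = x.1})) ⟨?_, ?_⟩ _ _ ?_
    · intro b b' hb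
      have hb' : ∀ x, e (w b x) = e (w b' x) := fun x => congrArg Subtype.val (congrFun hb x)
      obtain ⟨c, -, hc⟩ := h.sections y (fun x => e (w b x)) (fun x => (hw b x).1)
      have key : ∀ b'' : {b : B // q b = y}, (∀ x, e (w b x) = e (w b'' x)) → b''.1 = c := by
        intro b'' hb''
        refine hc b''.1 ⟨b''.2, fun v hv => ?_⟩
        have hfy : f (p (e v)) = y := by
          have := h.cartesian.comm v
          rw [hv, b''.2] at this
          exact this
        refine ⟨hfy, ?_⟩
        rw [hb'', ← hu b'' ⟨p (e v), hfy⟩ v ⟨rfl, hv⟩]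
      exact Subtype.ext ((key b fun _ => rfl).trans (key b' hb').symm)
    · intro s
      obtain ⟨b, ⟨hb, hs⟩, -⟩ := h.sections y (fun x => (s x).1) (fun x => (s x).2)
      refine ⟨⟨b, hb⟩, ?_⟩
      funext x
      apply Subtype.ext
      obtain ⟨h1, h2⟩ := hs (w ⟨b, hb⟩ x) (hw ⟨b, hb⟩ x).2
      have h3 : (⟨p (e (w ⟨b, hb⟩ x)), h1⟩ : {x : X // f x = y}) = x :=
        Subtype.ext (hw ⟨b, hb⟩ x).1
      change e (w ⟨b, hb⟩ x) = (s x).1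
      rw [← h2, h3]
    · intro b
      symm
      refine Fintype.prod_bijective
        (fun x => (⟨w b x, (hw b x).2⟩ : {v : W // f' v = b.1})) ⟨?_, ?_⟩ _ _ (fun x => rfl)
      · intro x x' hx
        have hx' : w b x = w b x' := congrArg Subtype.val hx
        exact Subtype.ext (by rw [← (hw b x).1, ← (hw b x').1, hx'])
      · rintro ⟨v, hv⟩
        have hfy : f (p (e v)) = y := by
          have := h.cartesian.comm v
          rw [hv, b.2] at this
          exact this
        exact ⟨⟨p (e v), hfy⟩, Subtype.ext (hu b ⟨p (e v), hfy⟩ v ⟨rfl, hv⟩).symm⟩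
  tr_mul_res {X Y} f a b := by
    ext y
    change ∑ x : {x : X // f x = y}, a.1 x.1 * b.1 (f x.1) =
      (∑ x : {x : X // f x = y}, a.1 x.1) * b.1 y
    rw [Finset.sum_mul]
    exact Finset.sum_congr rfl fun x _ => by rw [x.2]
  additive {X Y Z} i j h := by
    constructor
    · intro a b hab
      obtain ⟨h1, h2⟩ := Prod.ext_iff.1 hab
      ext z
      obtain ⟨x | x, rfl⟩ := h.2 z
      · exact congrFun (congrArg Subtype.val h1) x
      · exact congrFun (congrArg Subtype.val h2) x
    · rintro ⟨a, b⟩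
      let s := Equiv.ofBijective _ h
      have hl : ∀ x, s.symm (i x) = Sum.inl x := fun x => by
        rw [Equiv.symm_apply_eq]; rfl
      have hr : ∀ x, s.symm (j x) = Sum.inr x := fun x => by
        rw [Equiv.symm_apply_eq]; rfl
      refine ⟨⟨fun z => Sum.elim a.1 b.1 (s.symm z), fun g z => ?_⟩, ?_⟩
      · obtain ⟨x | x, rfl⟩ := h.2 z
        · simp only [Sum.elim_inl]
          rw [← map_smul, hl, hl]
          exact a.2 g x
        · simp only [Sum.elim_inr]
          rw [← map_smul, hr, hr]
          exact b.2 g x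
      · refine Prod.ext (Subtype.ext (funext fun x => ?_)) (Subtype.ext (funext fun x => ?_))
        · change Sum.elim a.1 b.1 (s.symm (i x)) = a.1 x
          rw [hl]; rfl
        · change Sum.elim a.1 b.1 (s.symm (j x)) = b.1 x
          rw [hr]; rfl
  additive_empty X hX := ⟨fun a b => Subtype.ext (funext fun x => hX.elim x)⟩

end FixedPoints

/-- The trivial action of `G` on a ring. -/
abbrev trivialAction (G : Type u) [Group G] (A : Type u) [CommRing A] : MulSemiringAction G A where
  smul _ a := a
  one_smul _ := rfl
  mul_smul _ _ _ := rfl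
  smul_zero _ := rfl
  smul_add _ _ _ := rfl
  smul_one _ := rfl
  smul_mul _ _ _ := rfl

/-- The constant Tambara functor at a commutative ring `A`: the fixed-point functor of `A` with
trivial action.  Its value on every orbit is `A`, with identity restrictions. -/
def constant (G : Type u) [Group G] (A : Type u) [CommRing A] : TambaraFunctor G :=
  letI := trivialAction G A
  FP G A

/-- The map from the constant Tambara functor at `K` to `FP(L)`, for a `K`-algebra `L` on which `G`
acts `K`-linearly; on `G/H` it is the inclusion `K → L^H`. -/
def constantToFP (G : Type u) [Group G] (K L : Type u) [CommRing K] [CommRing L] [Algebra K L]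
    [MulSemiringAction G L] [SMulCommClass G K L] : TambaraHom (constant G K) (FP G L) where
  app X :=
    { toFun := fun φ => ⟨fun x => algebraMap K L (φ.1 x), fun g x => by
        rw [smul_algebraMap]
        exact congrArg (algebraMap K L) (φ.2 g x)⟩
      map_one' := Subtype.ext (funext fun x => map_one (algebraMap K L))
      map_mul' := fun a b => Subtype.ext (funext fun x => map_mul (algebraMap K L) (a.1 x) (b.1 x))
      map_zero' := Subtype.ext (funext fun x => map_zero (algebraMap K L))
      map_add' := fun a b =>
        Subtype.ext (funext fun x => map_add (algebraMap K L) (a.1 x) (b.1 x)) }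
  app_res f a := rfl
  app_tr {X Y} f a := Subtype.ext (funext fun y =>
    map_sum (algebraMap K L) (fun x : {x : X // f x = y} => a.1 x.1) Finset.univ)
  app_nm {X Y} f a := Subtype.ext (funext fun y =>
    map_prod (algebraMap K L) (fun x : {x : X // f x = y} => a.1 x.1) Finset.univ)

end Tambara

/-! By the normal basis theorem, `L` has a `K`-basis `b` indexed by `G` with `b (g * h) = g • b h`.
Taking coordinates identifies equivariant functions `X → L` with invariant functions `X × G → K`,
compatibly with restrictions, transfers and scalars (`coordFun`). So `FP(L)` is an induced module
over the constant functor, and `FP(L) ⊠ N ≅ N(- × G)` naturally in `N` (`boxToProd_bijective`,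
`boxToProd_map`). The inverse tensors with the tautological element `(x, g) ↦ b g`. Exactness is
levelwise, so evaluation at `X × G` is exact and `FP(L)` is flat.

For `N = FP(L)` this gives `(FP(L) ⊠ FP(L))(X) ≅ FP(L)(X × G)`. Since `L ⊗_K L` is the ring of
functions `G → L`, the expected answer is `FP(L ⊗_K L)`. The comparison map is essentially
multiplication by the matrix `(g⁻¹ • b h)`, invertible by Dedekind's independence of characters
(`toAlg_prodToBox_bijective`). The kernel `I` of multiplication consists of the functions vanishing
at `1 ∈ G`, and is generated at each level by a `G`-invariant idempotent `e`. Every `a ∈ I` equals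
`a * e`, so products alone give `I ⊆ I^{>1}`.

For finite presentation, a single generator at level `G/e`, the normal basis, suffices: every `m` is
the transfer of its coordinates times a restriction of that generator. Free polynomial algebras are
built as formal expressions modulo the axioms. The Hilbert basis property makes the kernel of
evaluation finitely generated, and this yields the coequalizer
(`isFinitelyPresented_of_surjective`). -/

namespace Tambara

open FinGSet

variable {G : Type u} [Group G]

/-! ### Disjoint unions -/

namespace FinGSet

/-- The empty `G`-set. -/
def empty (G : Type u) [Group G] : FinGSet G where
  card := 0
  act := { smul := fun _ x => x, one_smul := fun _ => rfl, mul_smul := fun _ _ _ => rfl }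

instance : IsEmpty (empty G) := inferInstanceAs (IsEmpty (Fin 0))

/-- The map out of the empty `G`-set. -/
def fromEmpty (X : FinGSet G) : empty G →[G] X where
  toFun x := isEmptyElim x
  map_smul' _ x := isEmptyElim x

theorem IsCoprod.injective_left {X Y Z : FinGSet G} {i : X →[G] Z} {j : Y →[G] Z}
    (h : IsCoprod i j) : Function.Injective i := fun _ _ e =>
  Sum.inl_injective (h.1 e)

theorem IsCoprod.symm {X Y Z : FinGSet G} {i : X →[G] Z} {j : Y →[G] Z}
    (h : IsCoprod i j) : IsCoprod j i := by
  have e : (Sum.elim j i : Y ⊕ X → Z) = Sum.elim i j ∘ Sum.swap := by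
    funext x; cases x <;> rfl
  rw [IsCoprod, e]
  exact h.comp (Equiv.sumComm Y X).bijective

/-- The kernel pair of an injection is the diagonal, so base change makes restriction a left inverse
of transfer along `i`. -/
theorem isCartesian_of_injective {X Z : FinGSet G} {i : X →[G] Z} (h : Function.Injective i) :
    IsCartesian (MulActionHom.id G) (MulActionHom.id G) i i where
  comm _ := rfl
  lift x _ e := ⟨x, ⟨rfl, h e⟩, fun _ hw => hw.1⟩

/-- The two summands are disjoint, so their pullback is empty and the cross terms `res j (tr i a)`
vanish. -/
theorem IsCoprod.isCartesian {X Y Z : FinGSet G} {i : X →[G] Z} {j : Y →[G] Z}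
    (h : IsCoprod i j) : IsCartesian (fromEmpty X) (fromEmpty Y) i j where
  comm w := isEmptyElim w
  lift x y e := absurd (h.1 (a₁ := Sum.inl x) (a₂ := Sum.inr y) e) Sum.inl_ne_inr

end FinGSet

/-! ### Additivity expressed by an equation -/

namespace TambaraFunctor

variable (T : TambaraFunctor G)

theorem res_tr_of_injective {X Z : FinGSet G} {i : X →[G] Z} (h : Function.Injective i)
    (a : T.obj X) : T.res i (T.tr i a) = a := by
  rw [T.res_tr (isCartesian_of_injective h), T.res_id, T.tr_id]

theorem res_tr_of_isCoprod {X Y Z : FinGSet G} {i : X →[G] Z} {j : Y →[G] Z}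
    (h : IsCoprod i j) (a : T.obj X) : T.res j (T.tr i a) = 0 := by
  have := T.additive_empty (empty G) inferInstance
  rw [T.res_tr h.isCartesian, Subsingleton.elim (T.res (fromEmpty X) a) 0, map_zero]

/-- By additivity it is enough to compare the restrictions to both summands. The equation encodes
additivity in a form that can be imposed as a relation on formal expressions. -/
theorem tr_res_add_tr_res {X Y Z : FinGSet G} {i : X →[G] Z} {j : Y →[G] Z}
    (h : IsCoprod i j) (a : T.obj Z) : T.tr i (T.res i a) + T.tr j (T.res j a) = a := by
  refine (T.additive i j h).1 (Prod.ext ?_ ?_)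
  · simp [T.res_tr_of_injective h.injective_left, T.res_tr_of_isCoprod h.symm]
  · simp [T.res_tr_of_injective h.symm.injective_left, T.res_tr_of_isCoprod h]

end TambaraFunctor

theorem TambaraHom.congr_app {R S : TambaraFunctor G} {φ ψ : TambaraHom R S} (h : φ = ψ)
    (X : FinGSet G) (a : R.obj X) : φ.app X a = ψ.app X a := by rw [h]

/-! ### Free polynomial algebras -/

/-- Formal polynomial expressions over `k` in generators at the levels `X i`. -/
inductive PolyTerm (k : TambaraFunctor G) {n : ℕ} (X : Fin n → FinGSet G) : FinGSet G → Type u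
  | const {Y : FinGSet G} (a : k.obj Y) : PolyTerm k X Y
  | gen (i : Fin n) : PolyTerm k X (X i)
  | add {Y : FinGSet G} (a b : PolyTerm k X Y) : PolyTerm k X Y
  | mul {Y : FinGSet G} (a b : PolyTerm k X Y) : PolyTerm k X Y
  | res {Y Z : FinGSet G} (f : Y →[G] Z) (a : PolyTerm k X Z) : PolyTerm k X Y
  | tr {Y Z : FinGSet G} (f : Y →[G] Z) (a : PolyTerm k X Y) : PolyTerm k X Z
  | nm {Y Z : FinGSet G} (f : Y →[G] Z) (a : PolyTerm k X Y) : PolyTerm k X Z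

namespace PolyTerm

variable {k : TambaraFunctor G} {n : ℕ} {X : Fin n → FinGSet G}

/-- The congruence on polynomial expressions generated by the axioms of `k`-algebras. -/
inductive Rel : ∀ {Y : FinGSet G}, PolyTerm k X Y → PolyTerm k X Y → Prop
  | refl {Y : FinGSet G} (a : PolyTerm k X Y) : Rel a a
  | symm {Y : FinGSet G} {a b : PolyTerm k X Y} : Rel a b → Rel b a
  | trans {Y : FinGSet G} {a b c : PolyTerm k X Y} : Rel a b → Rel b c → Rel a c
  | add_congr {Y : FinGSet G} {a a' b b' : PolyTerm k X Y} :
      Rel a a' → Rel b b' → Rel (add a b) (add a' b')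
  | mul_congr {Y : FinGSet G} {a a' b b' : PolyTerm k X Y} :
      Rel a a' → Rel b b' → Rel (mul a b) (mul a' b')
  | res_congr {Y Z : FinGSet G} (f : Y →[G] Z) {a a' : PolyTerm k X Z} :
      Rel a a' → Rel (res f a) (res f a')
  | tr_congr {Y Z : FinGSet G} (f : Y →[G] Z) {a a' : PolyTerm k X Y} :
      Rel a a' → Rel (tr f a) (tr f a')
  | nm_congr {Y Z : FinGSet G} (f : Y →[G] Z) {a a' : PolyTerm k X Y} :
      Rel a a' → Rel (nm f a) (nm f a')
  | const_add {Y : FinGSet G} (a b : k.obj Y) : Rel (const (a + b)) (add (const a) (const b))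
  | const_mul {Y : FinGSet G} (a b : k.obj Y) : Rel (const (a * b)) (mul (const a) (const b))
  | const_res {Y Z : FinGSet G} (f : Y →[G] Z) (a : k.obj Z) :
      Rel (const (k.res f a)) (res f (const a))
  | const_tr {Y Z : FinGSet G} (f : Y →[G] Z) (a : k.obj Y) :
      Rel (const (k.tr f a)) (tr f (const a))
  | const_nm {Y Z : FinGSet G} (f : Y →[G] Z) (a : k.obj Y) :
      Rel (const (k.nm f a)) (nm f (const a))
  | add_assoc {Y : FinGSet G} (a b c : PolyTerm k X Y) : Rel (add (add a b) c) (add a (add b c))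
  | add_comm {Y : FinGSet G} (a b : PolyTerm k X Y) : Rel (add a b) (add b a)
  | zero_add {Y : FinGSet G} (a : PolyTerm k X Y) : Rel (add (const 0) a) a
  -- Negation is not an operation on expressions; multiplication by the constant `-1` provides
  -- additive inverses.
  | neg_add {Y : FinGSet G} (a : PolyTerm k X Y) : Rel (add (mul (const (-1)) a) a) (const 0)
  | mul_assoc {Y : FinGSet G} (a b c : PolyTerm k X Y) : Rel (mul (mul a b) c) (mul a (mul b c))
  | mul_comm {Y : FinGSet G} (a b : PolyTerm k X Y) : Rel (mul a b) (mul b a)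
  | one_mul {Y : FinGSet G} (a : PolyTerm k X Y) : Rel (mul (const 1) a) a
  | mul_add {Y : FinGSet G} (a b c : PolyTerm k X Y) :
      Rel (mul a (add b c)) (add (mul a b) (mul a c))
  | res_add {Y Z : FinGSet G} (f : Y →[G] Z) (a b : PolyTerm k X Z) :
      Rel (res f (add a b)) (add (res f a) (res f b))
  | res_mul {Y Z : FinGSet G} (f : Y →[G] Z) (a b : PolyTerm k X Z) :
      Rel (res f (mul a b)) (mul (res f a) (res f b))
  | tr_add {Y Z : FinGSet G} (f : Y →[G] Z) (a b : PolyTerm k X Y) :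
      Rel (tr f (add a b)) (add (tr f a) (tr f b))
  | nm_mul {Y Z : FinGSet G} (f : Y →[G] Z) (a b : PolyTerm k X Y) :
      Rel (nm f (mul a b)) (mul (nm f a) (nm f b))
  | res_id {Y : FinGSet G} (a : PolyTerm k X Y) : Rel (res (MulActionHom.id G) a) a
  | tr_id {Y : FinGSet G} (a : PolyTerm k X Y) : Rel (tr (MulActionHom.id G) a) a
  | nm_id {Y : FinGSet G} (a : PolyTerm k X Y) : Rel (nm (MulActionHom.id G) a) a
  | res_comp {Y Z W : FinGSet G} (g : Z →[G] W) (f : Y →[G] Z) (a : PolyTerm k X W) :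
      Rel (res (g.comp f) a) (res f (res g a))
  | tr_comp {Y Z W : FinGSet G} (g : Z →[G] W) (f : Y →[G] Z) (a : PolyTerm k X Y) :
      Rel (tr (g.comp f) a) (tr g (tr f a))
  | nm_comp {Y Z W : FinGSet G} (g : Z →[G] W) (f : Y →[G] Z) (a : PolyTerm k X Y) :
      Rel (nm (g.comp f) a) (nm g (nm f a))
  | res_tr {W Y Y' Z : FinGSet G} {g' : W →[G] Y} {f' : W →[G] Y'} {f : Y →[G] Z}
      {g : Y' →[G] Z} (h : IsCartesian g' f' f g) (a : PolyTerm k X Y) :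
      Rel (res g (tr f a)) (tr f' (res g' a))
  | res_nm {W Y Y' Z : FinGSet G} {g' : W →[G] Y} {f' : W →[G] Y'} {f : Y →[G] Z}
      {g : Y' →[G] Z} (h : IsCartesian g' f' f g) (a : PolyTerm k X Y) :
      Rel (res g (nm f a)) (nm f' (res g' a))
  | nm_tr {A Y Z W B : FinGSet G} {p : A →[G] Y} {f : Y →[G] Z} {e : W →[G] A}
      {f' : W →[G] B} {q : B →[G] Z} (h : IsExponential p f e f' q) (a : PolyTerm k X A) :
      Rel (nm f (tr p a)) (tr q (nm f' (res e a)))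
  | tr_mul_res {Y Z : FinGSet G} (f : Y →[G] Z) (a : PolyTerm k X Y) (b : PolyTerm k X Z) :
      Rel (tr f (mul a (res f b))) (mul (tr f a) b)
  | coprod {Y Y' Z : FinGSet G} (i : Y →[G] Z) (j : Y' →[G] Z) (h : IsCoprod i j)
      (a : PolyTerm k X Z) : Rel (add (tr i (res i a)) (tr j (res j a))) a
  | empty {Y : FinGSet G} (h : IsEmpty Y) (a b : PolyTerm k X Y) : Rel a b

/-- Evaluation of polynomial expressions in a `k`-algebra. -/
def eval {S : TambaraFunctor G} (σ : TambaraHom k S) (s : ∀ i, S.obj (X i)) :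
    ∀ {Y : FinGSet G}, PolyTerm k X Y → S.obj Y
  | _, const a => σ.app _ a
  | _, gen i => s i
  | _, add a b => eval σ s a + eval σ s b
  | _, mul a b => eval σ s a * eval σ s b
  | _, res f a => S.res f (eval σ s a)
  | _, tr f a => S.tr f (eval σ s a)
  | _, nm f a => S.nm f (eval σ s a)

/-- Each generating relation is an axiom or a consequence of the axioms for `S` and `σ`. This makes
evaluation well defined on the quotient. -/
theorem eval_eq_of_rel {S : TambaraFunctor G} (σ : TambaraHom k S) (s : ∀ i, S.obj (X i))
    {Y : FinGSet G} {a b : PolyTerm k X Y} (h : Rel a b) : eval σ s a = eval σ s b := by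
  induction h with
  | refl a => rfl
  | symm _ ih => exact ih.symm
  | trans _ _ ih ih' => exact ih.trans ih'
  | add_congr _ _ ih ih' => simp only [eval, ih, ih']
  | mul_congr _ _ ih ih' => simp only [eval, ih, ih']
  | res_congr f _ ih => simp only [eval, ih]
  | tr_congr f _ ih => simp only [eval, ih]
  | nm_congr f _ ih => simp only [eval, ih]
  | const_add a b => simp only [eval, map_add]
  | const_mul a b => simp only [eval, map_mul]
  | const_res f a => exact σ.app_res f a
  | const_tr f a => exact σ.app_tr f a
  | const_nm f a => exact σ.app_nm f a
  | add_assoc a b c => exact _root_.add_assoc _ _ _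
  | add_comm a b => exact _root_.add_comm _ _
  | zero_add a => simp [eval]
  | neg_add a => simp [eval]
  | mul_assoc a b c => exact _root_.mul_assoc _ _ _
  | mul_comm a b => exact _root_.mul_comm _ _
  | one_mul a => simp [eval]
  | mul_add a b c => exact _root_.mul_add _ _ _
  | res_add f a b => exact map_add (S.res f) _ _
  | res_mul f a b => exact map_mul (S.res f) _ _
  | tr_add f a b => exact map_add (S.tr f) _ _
  | nm_mul f a b => exact map_mul (S.nm f) _ _
  | res_id a => exact S.res_id _ _
  | tr_id a => exact S.tr_id _ _
  | nm_id a => exact S.nm_id _ _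
  | res_comp g f a => exact S.res_comp g f _
  | tr_comp g f a => exact S.tr_comp g f _
  | nm_comp g f a => exact S.nm_comp g f _
  | res_tr h a => exact S.res_tr h _
  | res_nm h a => exact S.res_nm h _
  | nm_tr h a => exact S.nm_tr h _
  | tr_mul_res f a b => exact S.tr_mul_res f _ _
  | coprod i j h a => exact S.tr_res_add_tr_res h _
  | empty h a b =>
    have := S.additive_empty _ h
    exact Subsingleton.elim _ _

/-- Polynomial expressions up to the axioms of `k`-algebras. -/
def setoid (k : TambaraFunctor G) {n : ℕ} (X : Fin n → FinGSet G) (Y : FinGSet G) :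
    Setoid (PolyTerm k X Y) where
  r := Rel
  iseqv := ⟨.refl, .symm, .trans⟩

end PolyTerm

/-- The value at `Y` of the free polynomial `k`-algebra on generators in levels `X i`. -/
def PolyObj (k : TambaraFunctor G) {n : ℕ} (X : Fin n → FinGSet G) (Y : FinGSet G) : Type u :=
  Quotient (PolyTerm.setoid k X Y)

namespace PolyObj

open PolyTerm

variable {k : TambaraFunctor G} {n : ℕ} {X : Fin n → FinGSet G}

/-- The class of a polynomial expression. -/
def mk {Y : FinGSet G} (a : PolyTerm k X Y) : PolyObj k X Y := Quotient.mk _ a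

theorem sound {Y : FinGSet G} {a b : PolyTerm k X Y} (h : Rel a b) : mk a = mk b :=
  Quotient.sound h

theorem mk_surjective {Y : FinGSet G} (a : PolyObj k X Y) : ∃ t, mk t = a := Quotient.exists_rep a

instance {Y : FinGSet G} : Add (PolyObj k X Y) :=
  ⟨Quotient.map₂ add fun _ _ h _ _ h' => Rel.add_congr h h'⟩

instance {Y : FinGSet G} : Mul (PolyObj k X Y) :=
  ⟨Quotient.map₂ mul fun _ _ h _ _ h' => Rel.mul_congr h h'⟩

instance {Y : FinGSet G} : Zero (PolyObj k X Y) := ⟨mk (const 0)⟩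

instance {Y : FinGSet G} : One (PolyObj k X Y) := ⟨mk (const 1)⟩

instance {Y : FinGSet G} : Neg (PolyObj k X Y) := ⟨fun a => mk (const (-1)) * a⟩

protected theorem add_comm {Y : FinGSet G} (a b : PolyObj k X Y) : a + b = b + a :=
  Quotient.inductionOn₂ a b fun _ _ => sound (.add_comm _ _)

protected theorem mul_comm {Y : FinGSet G} (a b : PolyObj k X Y) : a * b = b * a :=
  Quotient.inductionOn₂ a b fun _ _ => sound (.mul_comm _ _)

protected theorem zero_add {Y : FinGSet G} (a : PolyObj k X Y) : 0 + a = a :=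
  Quotient.inductionOn a fun _ => sound (.zero_add _)

protected theorem one_mul {Y : FinGSet G} (a : PolyObj k X Y) : 1 * a = a :=
  Quotient.inductionOn a fun _ => sound (.one_mul _)

protected theorem mul_add {Y : FinGSet G} (a b c : PolyObj k X Y) : a * (b + c) = a * b + a * c :=
  Quotient.inductionOn₃ a b c fun _ _ _ => sound (.mul_add _ _ _)

protected theorem neg_add_cancel {Y : FinGSet G} (a : PolyObj k X Y) : -a + a = 0 :=
  Quotient.inductionOn a fun _ => sound (.neg_add _)

protected theorem add_assoc {Y : FinGSet G} (a b c : PolyObj k X Y) : a + b + c = a + (b + c) :=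
  Quotient.inductionOn₃ a b c fun _ _ _ => sound (.add_assoc _ _ _)

/-- Absorption by zero is not among the relations; it follows from distributivity and cancellation.
-/
protected theorem zero_mul {Y : FinGSet G} (a : PolyObj k X Y) : 0 * a = 0 := by
  have h : a * 0 + a * 0 = a * 0 := by rw [← PolyObj.mul_add, PolyObj.zero_add]
  calc 0 * a = 0 + a * 0 := by rw [PolyObj.zero_add, PolyObj.mul_comm]
    _ = -(a * 0) + (a * 0 + a * 0) := by rw [← PolyObj.add_assoc, PolyObj.neg_add_cancel]
    _ = -(a * 0) + a * 0 := by rw [h]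
    _ = 0 := PolyObj.neg_add_cancel _

instance {Y : FinGSet G} : CommRing (PolyObj k X Y) where
  add_assoc := PolyObj.add_assoc
  zero_add := PolyObj.zero_add
  add_zero a := by rw [PolyObj.add_comm, PolyObj.zero_add]
  add_comm := PolyObj.add_comm
  nsmul := nsmulRec
  zsmul := zsmulRec
  neg_add_cancel := PolyObj.neg_add_cancel
  mul_assoc a b c := Quotient.inductionOn₃ a b c fun _ _ _ => sound (.mul_assoc _ _ _)
  one_mul := PolyObj.one_mul
  mul_one a := by rw [PolyObj.mul_comm, PolyObj.one_mul]
  left_distrib := PolyObj.mul_add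
  right_distrib a b c := by
    rw [PolyObj.mul_comm, PolyObj.mul_add, PolyObj.mul_comm c, PolyObj.mul_comm c]
  zero_mul := PolyObj.zero_mul
  mul_zero a := by rw [PolyObj.mul_comm, PolyObj.zero_mul]
  mul_comm := PolyObj.mul_comm

/-- Restriction. -/
def res {Y Z : FinGSet G} (f : Y →[G] Z) : PolyObj k X Z →+* PolyObj k X Y where
  toFun := Quotient.map (PolyTerm.res f) fun _ _ => Rel.res_congr f
  -- Zero and one are classes of constants, so their preservation is inherited from `k`.
  map_zero' := sound (((Rel.const_res f 0).symm).trans (by rw [map_zero]; exact .refl _))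
  map_one' := sound (((Rel.const_res f 1).symm).trans (by rw [map_one]; exact .refl _))
  map_add' a b := Quotient.inductionOn₂ a b fun _ _ => sound (.res_add f _ _)
  map_mul' a b := Quotient.inductionOn₂ a b fun _ _ => sound (.res_mul f _ _)

/-- Transfer. -/
def tr {Y Z : FinGSet G} (f : Y →[G] Z) : PolyObj k X Y →+ PolyObj k X Z where
  toFun := Quotient.map (PolyTerm.tr f) fun _ _ => Rel.tr_congr f
  map_zero' := sound (((Rel.const_tr f 0).symm).trans (by rw [map_zero]; exact .refl _))
  map_add' a b := Quotient.inductionOn₂ a b fun _ _ => sound (.tr_add f _ _)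

/-- Norm. -/
def nm {Y Z : FinGSet G} (f : Y →[G] Z) : PolyObj k X Y →* PolyObj k X Z where
  toFun := Quotient.map (PolyTerm.nm f) fun _ _ => Rel.nm_congr f
  map_one' := sound (((Rel.const_nm f 1).symm).trans (by rw [map_one]; exact .refl _))
  map_mul' a b := Quotient.inductionOn₂ a b fun _ _ => sound (.nm_mul f _ _)

theorem res_tr {W Y Y' Z : FinGSet G} {g' : W →[G] Y} {f' : W →[G] Y'} {f : Y →[G] Z}
    {g : Y' →[G] Z} (h : IsCartesian g' f' f g) (a : PolyObj k X Y) :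
    res g (tr f a) = tr f' (res g' a) :=
  Quotient.inductionOn a fun _ => sound (.res_tr h _)

theorem eq_of_isEmpty {Y : FinGSet G} (h : IsEmpty Y) (a b : PolyObj k X Y) : a = b :=
  Quotient.inductionOn₂ a b fun _ _ => sound (.empty h _ _)

/-- This and the next lemma repeat the computations made for Tambara functors, because they are
needed to prove that `PolyObj` forms one. -/
theorem res_tr_self {Y Z : FinGSet G} {i : Y →[G] Z} (h : Function.Injective i)
    (a : PolyObj k X Y) : res i (tr i a) = a := by
  rw [res_tr (isCartesian_of_injective h)]
  exact Quotient.inductionOn a fun _ => sound ((Rel.tr_id _).trans (.res_id _))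

theorem res_tr_of_isCoprod {Y Y' Z : FinGSet G} {i : Y →[G] Z} {j : Y' →[G] Z}
    (h : IsCoprod i j) (a : PolyObj k X Y) : res j (tr i a) = 0 := by
  rw [res_tr h.isCartesian, eq_of_isEmpty inferInstance (res (fromEmpty Y) a) 0, map_zero]

end PolyObj

/-- The free polynomial `k`-algebra on generators in levels `X i`. -/
def polynomialFunctor (k : TambaraFunctor G) {n : ℕ} (X : Fin n → FinGSet G) :
    TambaraFunctor G where
  obj := PolyObj k X
  res := PolyObj.res
  tr := PolyObj.tr
  nm := PolyObj.nm
  res_id X a := Quotient.inductionOn a fun _ => PolyObj.sound (.res_id _)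
  tr_id X a := Quotient.inductionOn a fun _ => PolyObj.sound (.tr_id _)
  nm_id X a := Quotient.inductionOn a fun _ => PolyObj.sound (.nm_id _)
  res_comp g f a := Quotient.inductionOn a fun _ => PolyObj.sound (.res_comp g f _)
  tr_comp g f a := Quotient.inductionOn a fun _ => PolyObj.sound (.tr_comp g f _)
  nm_comp g f a := Quotient.inductionOn a fun _ => PolyObj.sound (.nm_comp g f _)
  res_tr := PolyObj.res_tr
  res_nm h a := Quotient.inductionOn a fun _ => PolyObj.sound (.res_nm h _)
  nm_tr h a := Quotient.inductionOn a fun _ => PolyObj.sound (.nm_tr h _)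
  tr_mul_res f a b := Quotient.inductionOn₂ a b fun _ _ => PolyObj.sound (.tr_mul_res f _ _)
  additive {Y Y' Z} i j h := by
    -- The relation `coprod` recovers an element from its two restrictions, which gives injectivity.
    -- The same formula applied to an arbitrary pair gives a preimage.
    have glue (a : PolyObj k X Z) :
        PolyObj.tr i (PolyObj.res i a) + PolyObj.tr j (PolyObj.res j a) = a :=
      Quotient.inductionOn a fun _ => PolyObj.sound (.coprod i j h _)
    refine ⟨fun a b e => ?_, fun c => ⟨PolyObj.tr i c.1 + PolyObj.tr j c.2, ?_⟩⟩
    · obtain ⟨h1, h2⟩ := Prod.ext_iff.1 e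
      rw [← glue a, ← glue b]
      exact congrArg₂ (· + ·) (congrArg _ h1) (congrArg _ h2)
    · refine Prod.ext ?_ ?_
      · simp [PolyObj.res_tr_self h.injective_left, PolyObj.res_tr_of_isCoprod h.symm]
      · simp [PolyObj.res_tr_self h.symm.injective_left, PolyObj.res_tr_of_isCoprod h]
  additive_empty Y h := ⟨PolyObj.eq_of_isEmpty h⟩

/-- The structure map of the free polynomial `k`-algebra. -/
def polynomialMap (k : TambaraFunctor G) {n : ℕ} (X : Fin n → FinGSet G) :
    TambaraHom k (polynomialFunctor k X) where
  app Y :=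
    { toFun := fun a => (PolyObj.mk (.const a) : PolyObj k X Y)
      map_zero' := rfl
      map_one' := rfl
      map_add' := fun a b => PolyObj.sound (.const_add a b)
      map_mul' := fun a b => PolyObj.sound (.const_mul a b) }
  app_res f a := PolyObj.sound (.const_res f a)
  app_tr f a := PolyObj.sound (.const_tr f a)
  app_nm f a := PolyObj.sound (.const_nm f a)

/-- The map out of the free polynomial `k`-algebra with given values on the generators. -/
def polynomialEval {k : TambaraFunctor G} {n : ℕ} {X : Fin n → FinGSet G} {S : TambaraFunctor G}
    (σ : TambaraHom k S) (s : ∀ i, S.obj (X i)) : TambaraHom (polynomialFunctor k X) S where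
  app Y :=
    { toFun := Quotient.lift (PolyTerm.eval σ s) fun _ _ => PolyTerm.eval_eq_of_rel σ s
      map_zero' := map_zero (σ.app Y)
      map_one' := map_one (σ.app Y)
      map_add' := fun a b => Quotient.inductionOn₂ a b fun _ _ => rfl
      map_mul' := fun a b => Quotient.inductionOn₂ a b fun _ _ => rfl }
  app_res _ a := Quotient.inductionOn a fun _ => rfl
  app_tr _ a := Quotient.inductionOn a fun _ => rfl
  app_nm _ a := Quotient.inductionOn a fun _ => rfl

/-- Existence is evaluation. Uniqueness is induction on expressions, since a morphism commutes with
every operation and is prescribed on constants and generators. -/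
theorem isFreePolynomial_polynomialMap (k : TambaraFunctor G) {n : ℕ} (X : Fin n → FinGSet G) :
    IsFreePolynomial (polynomialMap k X) X (fun i => PolyObj.mk (.gen i)) := by
  intro S σ s
  refine ⟨polynomialEval σ s, ⟨rfl, fun i => rfl⟩, ?_⟩
  rintro t ⟨rfl, h⟩
  ext Y a
  obtain ⟨a, rfl⟩ := PolyObj.mk_surjective a
  change t.app Y (PolyObj.mk a) = PolyTerm.eval _ s a
  induction a with
  | const a => rfl
  | gen i => exact h i
  | add a b iha ihb =>
    rw [PolyTerm.eval, ← iha, ← ihb]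
    exact map_add (t.app _) (PolyObj.mk a) (PolyObj.mk b)
  | mul a b iha ihb =>
    rw [PolyTerm.eval, ← iha, ← ihb]
    exact map_mul (t.app _) (PolyObj.mk a) (PolyObj.mk b)
  | res f a ih => rw [PolyTerm.eval, ← ih]; exact t.app_res f (PolyObj.mk a)
  | tr f a ih => rw [PolyTerm.eval, ← ih]; exact t.app_tr f (PolyObj.mk a)
  | nm f a ih => rw [PolyTerm.eval, ← ih]; exact t.app_nm f (PolyObj.mk a)

/-! ### Finite presentation from the Hilbert basis theorem -/

theorem TambaraIdeal.subset_span {T : TambaraFunctor G} {S : Set (Σ X : FinGSet G, T.obj X)}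
    {s : Σ X : FinGSet G, T.obj X} (hs : s ∈ S) : s.2 ∈ (span S).carrier s.1 := by
  simp only [span, Submodule.mem_iInf]
  exact fun I => I.2 s hs

theorem TambaraIdeal.span_le {T : TambaraFunctor G} {S : Set (Σ X : FinGSet G, T.obj X)}
    {I : TambaraIdeal T} (h : ∀ s ∈ S, s.2 ∈ I.carrier s.1) (X : FinGSet G) :
    (span S).carrier X ≤ I.carrier X :=
  iInf_le (fun I : {I : TambaraIdeal T // ∀ s ∈ S, s.2 ∈ I.carrier s.1} => I.1.carrier X) ⟨I, h⟩

/-- A map whose kernel contains the kernel of a levelwise surjective map `q` factors uniquely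
through `q`. -/
theorem existsUnique_comp_eq_of_ker_le {P R S : TambaraFunctor G} (q : TambaraHom P R)
    (hq : ∀ X, Function.Surjective (q.app X)) (t : TambaraHom P S)
    (h : ∀ X, (TambaraIdeal.ker q).carrier X ≤ (TambaraIdeal.ker t).carrier X) :
    ∃! v : TambaraHom R S, v.comp q = t := by
  -- The factorization is that of commutative rings at each level; compatibility with the operations
  -- is checked on preimages under `q`.
  let v (X : FinGSet G) : R.obj X →+* S.obj X :=
    (q.app X).liftOfSurjective (hq X) ⟨t.app X, h X⟩
  have hv (X : FinGSet G) (a : P.obj X) : v X (q.app X a) = t.app X a :=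
    (q.app X).liftOfRightInverse_comp_apply _ _ ⟨t.app X, h X⟩ a
  refine ⟨⟨v, fun {X Y} f a => ?_, fun {X Y} f a => ?_, fun {X Y} f a => ?_⟩, ?_, ?_⟩
  · obtain ⟨a, rfl⟩ := hq _ a
    rw [← q.app_res, hv, hv, t.app_res]
  · obtain ⟨a, rfl⟩ := hq _ a
    rw [← q.app_tr, hv, hv, t.app_tr]
  · obtain ⟨a, rfl⟩ := hq _ a
    rw [← q.app_nm, hv, hv, t.app_nm]
  · ext X a
    exact hv X a
  · rintro w rfl
    ext X a
    obtain ⟨a, rfl⟩ := hq _ a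
    exact (hv X a).symm

/-- Choose finitely many generators `s i` of the kernel of evaluation `P → R`. The source `Q` is
free with one generator in the level of each `s i`; one map sends these generators to the `s i`, the
other sends them to `0`, and their coequalizer is `P` modulo the kernel. -/
theorem isFinitelyPresented_of_surjective {k R : TambaraFunctor G} (φ : TambaraHom k R)
    (hk : SatisfiesHilbertBasis k) {n : ℕ} (X : Fin n → FinGSet G) (x : ∀ i, R.obj (X i))
    (hx : ∀ Y, Function.Surjective ((polynomialEval φ x).app Y)) : IsFinitelyPresented φ := by
  have hP : IsFinFreePolynomial (polynomialMap k X) := ⟨n, X, _, isFreePolynomial_polynomialMap k X⟩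
  obtain ⟨S, hS, hspan⟩ := hk _ _ hP (TambaraIdeal.ker (polynomialEval φ x))
  obtain ⟨m, s, -, rfl⟩ := hS.fin_param
  have hker (i : Fin m) : (polynomialEval φ x).app (s i).1 (s i).2 = 0 := by
    have := TambaraIdeal.subset_span (Set.mem_range_self (f := s) i)
    rwa [hspan] at this
  refine ⟨polynomialFunctor k (fun i => (s i).1), polynomialFunctor k X, polynomialMap k _,
    polynomialMap k X, polynomialEval (polynomialMap k X) (fun i => (s i).2),
    polynomialEval (polynomialMap k X) (fun i => 0), polynomialEval φ x,
    ⟨m, _, _, isFreePolynomial_polynomialMap k _⟩, hP, rfl, rfl, rfl, ?_, fun T t ht => ?_⟩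
  -- Both composites `Q → R` are maps of `k`-algebras that kill the generators, so they agree by
  -- freeness.
  · refine (isFreePolynomial_polynomialMap k (fun i => (s i).1) R φ (fun i => 0)).unique
      ⟨rfl, fun i => hker i⟩ ⟨rfl, fun i => map_zero ((polynomialEval φ x).app (s i).1)⟩
  · refine existsUnique_comp_eq_of_ker_le _ hx t fun Y => ?_
    rw [← hspan]
    refine TambaraIdeal.span_le ?_ Y
    rintro _ ⟨i, rfl⟩
    -- Evaluating the equality of composites at the `i`-th generator gives `t (s i) = t 0 = 0`.
    exact (TambaraHom.congr_app ht (s i).1 (PolyObj.mk (.gen i))).trans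
      (map_zero (t.app (s i).1))

/-! ### Products with the regular `G`-set -/

namespace FinGSet

/-- A model of a finite `G`-set. -/
noncomputable def model (G : Type u) [Group G] (S : Type*) [Finite S] [MulAction G S] : FinGSet G :=
  (exists_model (G := G) S).choose

/-- The bijection of a finite `G`-set with its model. -/
noncomputable def modelEquiv (S : Type*) [Finite S] [MulAction G S] : S ≃ model G S :=
  (exists_model (G := G) S).choose_spec.choose

theorem modelEquiv_smul {S : Type*} [Finite S] [MulAction G S] (g : G) (s : S) :
    modelEquiv (G := G) S (g • s) = g • modelEquiv S s :=
  (exists_model (G := G) S).choose_spec.choose_spec g s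

theorem modelEquiv_symm_smul {S : Type*} [Finite S] [MulAction G S] (g : G) (s : model G S) :
    (modelEquiv (G := G) S).symm (g • s) = g • (modelEquiv S).symm s := by
  rw [Equiv.symm_apply_eq, modelEquiv_smul, Equiv.apply_symm_apply]

variable [Finite G]

/-- The regular `G`-set. -/
noncomputable def regular (G : Type u) [Group G] [Finite G] : FinGSet G := model G G

/-- The product `X × G` with the diagonal action. -/
noncomputable def prodG (X : FinGSet G) : FinGSet G := model G (X × G)

/-- Elements of `X × G`. -/
noncomputable def pairG {X : FinGSet G} (x : X) (g : G) : prodG X := modelEquiv (X × G) (x, g)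

/-- The second coordinate. -/
noncomputable def sndG {X : FinGSet G} (p : prodG X) : G := ((modelEquiv (X × G)).symm p).2

/-- The first projection. -/
noncomputable def fstG (X : FinGSet G) : prodG X →[G] X where
  toFun p := ((modelEquiv (X × G)).symm p).1
  map_smul' g p := congrArg Prod.fst (modelEquiv_symm_smul g p)

@[simp] theorem fstG_pairG {X : FinGSet G} (x : X) (g : G) : fstG X (pairG x g) = x :=
  congrArg Prod.fst ((modelEquiv (X × G)).symm_apply_apply (x, g))

@[simp] theorem sndG_pairG {X : FinGSet G} (x : X) (g : G) : sndG (pairG x g) = g :=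
  congrArg Prod.snd ((modelEquiv (X × G)).symm_apply_apply (x, g))

@[simp] theorem pairG_fstG_sndG {X : FinGSet G} (p : prodG X) : pairG (fstG X p) (sndG p) = p :=
  (modelEquiv (X × G)).apply_symm_apply p

theorem smul_pairG {X : FinGSet G} (h : G) (x : X) (g : G) :
    h • pairG x g = pairG (h • x) (h * g) :=
  (modelEquiv_smul h (x, g)).symm

@[simp] theorem sndG_smul {X : FinGSet G} (h : G) (p : prodG X) : sndG (h • p) = h * sndG p :=
  congrArg Prod.snd (modelEquiv_symm_smul h p)

theorem prodG_ext {X : FinGSet G} {p q : prodG X} (h1 : fstG X p = fstG X q)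
    (h2 : sndG p = sndG q) : p = q := by
  rw [← pairG_fstG_sndG p, ← pairG_fstG_sndG q, h1, h2]

/-- The map `f × G`. -/
noncomputable def mapG {X Y : FinGSet G} (f : X →[G] Y) : prodG X →[G] prodG Y where
  toFun p := pairG (f (fstG X p)) (sndG p)
  map_smul' h p := by simp only [sndG_smul, map_smul, smul_pairG, id]

@[simp] theorem fstG_mapG {X Y : FinGSet G} (f : X →[G] Y) (p : prodG X) :
    fstG Y (mapG f p) = f (fstG X p) := fstG_pairG _ _

@[simp] theorem sndG_mapG {X Y : FinGSet G} (f : X →[G] Y) (p : prodG X) :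
    sndG (mapG f p) = sndG p := sndG_pairG _ _

/-- The map `(x, g) ↦ ((x, g), g)`. -/
noncomputable def diagG (X : FinGSet G) : prodG X →[G] prodG (prodG X) where
  toFun p := pairG p (sndG p)
  map_smul' h p := by simp only [sndG_smul, smul_pairG, id]

@[simp] theorem fstG_diagG {X : FinGSet G} (p : prodG X) : fstG _ (diagG X p) = p := fstG_pairG _ _

@[simp] theorem sndG_diagG {X : FinGSet G} (p : prodG X) : sndG (diagG X p) = sndG p :=
  sndG_pairG _ _

/-- The second projection, as an equivariant map. -/
noncomputable def toRegular (X : FinGSet G) : prodG X →[G] regular G where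
  toFun p := modelEquiv G (sndG p)
  map_smul' h p := by rw [sndG_smul, ← smul_eq_mul, modelEquiv_smul]; rfl

theorem mapG_comp {X Y Z : FinGSet G} (g : Y →[G] Z) (f : X →[G] Y) :
    mapG (g.comp f) = (mapG g).comp (mapG f) := by
  ext p : 1
  refine prodG_ext ?_ ?_ <;> simp

theorem fstG_comp_mapG {X Y : FinGSet G} (f : X →[G] Y) :
    (fstG Y).comp (mapG f) = f.comp (fstG X) := by
  ext p : 1
  simp

/-- The diagonal is a common section of the two projections `X × G × G → X × G` that forget one copy
of `G`. These two identities collapse the composite in `boxToProd_prodToBox`. -/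
theorem fstG_comp_diagG (X : FinGSet G) : (fstG _).comp (diagG X) = MulActionHom.id G := by
  ext p : 1
  simp

theorem mapG_fstG_comp_diagG (X : FinGSet G) :
    (mapG (fstG X)).comp (diagG X) = MulActionHom.id G := by
  ext p : 1
  refine prodG_ext ?_ ?_ <;> simp

/-- The map `f × G` is the base change of `f` along the projection, so restriction to `- × G`
commutes with transfers. -/
theorem isCartesian_mapG {X Y : FinGSet G} (f : X →[G] Y) :
    IsCartesian (fstG X) (mapG f) f (fstG Y) where
  comm p := (fstG_mapG f p).symm
  lift x p h := by
    refine ⟨pairG x (sndG p), ⟨fstG_pairG _ _, prodG_ext ?_ ?_⟩, fun w hw => prodG_ext ?_ ?_⟩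
    · simpa using h
    · simp
    · simpa using hw.1
    · rw [sndG_pairG, ← hw.2, sndG_mapG]

/-- Each fibre of the projection is a copy of `G`; this turns transfers along `fstG` into sums over
the basis. -/
theorem sum_fibre_fstG [Fintype G] {A : Type*} [AddCommMonoid A] {X : FinGSet G} (x : X)
    (φ : prodG X → A) : ∑ p : {p // fstG X p = x}, φ p.1 = ∑ g : G, φ (pairG x g) :=
  (Fintype.sum_bijective (fun g : G => (⟨pairG x g, fstG_pairG x g⟩ : {p // fstG X p = x}))
    ⟨fun g h e => by simpa using congrArg (fun p => sndG p.1) e, fun p =>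
      ⟨sndG p.1, Subtype.ext (prodG_ext (by simpa using p.2.symm) (by simp))⟩⟩ _ _
    fun _ => rfl).symm

end FinGSet

/-! ### Box products -/

namespace Box

variable {k : TambaraFunctor G} {M N : Mod k} {X A B : FinGSet G}

theorem mk_eq_zero_of_rel {r : FreeAbelianGroup (BoxSymbol M N X)} (h : BoxRel M N X r) :
    (QuotientAddGroup.mk r : Box M N X) = 0 :=
  (QuotientAddGroup.eq_zero_iff r).2 (AddSubgroup.subset_closure h)

theorem mk_add_right (f : A →[G] X) (m : M.obj A) (n n' : N.obj A) :
    mk M N f m (n + n') = mk M N f m n + mk M N f m n' := by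
  have := mk_eq_zero_of_rel (.add_right A f m n n')
  simp only [QuotientAddGroup.mk_sub, sub_sub] at this
  exact sub_eq_zero.1 this

theorem mk_balanced (f : A →[G] X) (c : k.obj A) (m : M.obj A) (n : N.obj A) :
    mk M N f (c • m) n = mk M N f m (c • n) :=
  sub_eq_zero.1 (mk_eq_zero_of_rel (.balanced A f c m n))

theorem mk_tr_left (g : A →[G] B) (f : B →[G] X) (m : M.obj A) (n : N.obj B) :
    mk M N f (M.tr g m) n = mk M N (f.comp g) m (N.res g n) :=
  sub_eq_zero.1 (mk_eq_zero_of_rel (.tr_left A B g f m n))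

theorem mk_tr_right (g : A →[G] B) (f : B →[G] X) (m : M.obj B) (n : N.obj A) :
    mk M N f m (N.tr g n) = mk M N (f.comp g) (M.res g m) n :=
  sub_eq_zero.1 (mk_eq_zero_of_rel (.tr_right A B g f m n))

theorem hom_ext {C : Type*} [AddCommGroup C] {F F' : Box M N X →+ C}
    (h : ∀ (A : FinGSet G) (f : A →[G] X) (m : M.obj A) (n : N.obj A),
      F (mk M N f m n) = F' (mk M N f m n)) : F = F' := by
  refine QuotientAddGroup.addMonoidHom_ext _ (FreeAbelianGroup.lift_ext _ _ fun s => ?_)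
  exact h s.A s.f s.m s.n

theorem map_mk {N' : Mod k} (i : ModHom N N') (f : A →[G] X) (m : M.obj A) (n : N.obj A) :
    map M i X (mk M N f m n) = mk M N' f m (i.app A n) :=
  FreeAbelianGroup.lift_apply_of _ _

theorem toAlg_mk {k R P : TambaraFunctor G} (φ : TambaraHom k R) (i j : TambaraHom R P)
    (h : i.comp φ = j.comp φ) (f : A →[G] X) (m n : R.obj A) :
    toAlg φ i j h X (mk φ.toMod φ.toMod f m n) = P.tr f (i.app A m * j.app A n) :=
  FreeAbelianGroup.lift_apply_of _ _

end Box

/-! ### Functoriality of fixed-point functors -/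

section

variable {A B : Type u} [CommRing A] [CommRing B] [MulSemiringAction G A] [MulSemiringAction G B]

theorem FP.ext {X : FinGSet G} {a b : (FP G A).obj X} (h : ∀ x, a.1 x = b.1 x) : a = b :=
  Subtype.ext (funext h)

/-- The map of fixed-point functors induced by an equivariant ring homomorphism. -/
def FP.map (u : A →+* B) (hu : ∀ (g : G) (a : A), u (g • a) = g • u a) :
    TambaraHom (FP G A) (FP G B) where
  app _ :=
    { toFun := fun φ => ⟨fun x => u (φ.1 x), fun g x =>
        (congrArg u (φ.2 g x)).trans (hu g _)⟩
      map_one' := FP.ext fun _ => map_one u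
      map_mul' := fun a b => FP.ext fun x => map_mul u (a.1 x) (b.1 x)
      map_zero' := FP.ext fun _ => map_zero u
      map_add' := fun a b => FP.ext fun x => map_add u (a.1 x) (b.1 x) }
  app_res _ _ := rfl
  app_tr f a := FP.ext fun y => map_sum u (fun x : {x // f x = y} => a.1 x.1) Finset.univ
  app_nm f a := FP.ext fun y => map_prod u (fun x : {x // f x = y} => a.1 x.1) Finset.univ

end

/-! ### Coordinates with respect to a normal basis -/

section NormalBasis

variable {K L : Type u} [Field K] [Field L] [Algebra K L] [MulSemiringAction G L]
  [SMulCommClass G K L]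

/-- This is the normal basis theorem for `Gal(L/K)`, reindexed along the isomorphism `G ≃ Gal(L/K)`:
the basis is the orbit of one element, so `G` permutes it by left translation. -/
theorem exists_normalBasis (G K L : Type u) [Group G] [Finite G] [Field K] [Field L] [Algebra K L]
    [MulSemiringAction G L] [IsGaloisGroup G K L] :
    ∃ b : Module.Basis G K L, ∀ g h, b (g * h) = g • b h := by
  have := IsGaloisGroup.isGalois G K L
  have := IsGaloisGroup.finiteDimensional G K L
  let e := IsGaloisGroup.mulEquivAlgEquiv G K L
  have he (g : G) (x : L) : e g x = g • x := rfl
  refine ⟨(IsGalois.normalBasis K L).reindex e.symm.toEquiv, fun g h => ?_⟩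
  have key (g : G) : (IsGalois.normalBasis K L).reindex e.symm.toEquiv g =
      g • IsGalois.normalBasis K L 1 := by
    rw [Module.Basis.reindex_apply, ← he]
    exact IsGalois.normalBasis_apply (e g)
  rw [key, key, mul_smul]

variable {b : Module.Basis G K L}

/-- Both sides are `K`-linear in `l` and agree on basis vectors. It is what makes the coordinates of
an equivariant function invariant under the diagonal action on `X × G`. -/
theorem repr_smul_mul (hb : ∀ g h, b (g * h) = g • b h) (g h : G) (l : L) :
    b.repr (g • l) (g * h) = b.repr l h := by
  have : b.coord (g * h) ∘ₗ DistribSMul.toLinearMap K L g = b.coord h :=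
    b.ext fun i => by
      change b.repr (g • b i) (g * h) = b.repr (b i) h
      classical
      rw [← hb, b.repr_self, b.repr_self, Finsupp.single_apply, Finsupp.single_apply]
      simp
  exact LinearMap.congr_fun this l

end NormalBasis

section NormalBasis

variable {K L : Type u} [Field K] [Field L] [Algebra K L] [MulSemiringAction G L]
  {b : Module.Basis G K L}

theorem constant_ext {X : FinGSet G} {a b : (constant G K).obj X} (h : ∀ x, a.1 x = b.1 x) :
    a = b :=
  Subtype.ext (funext h)

theorem constant_tr_apply {X Y : FinGSet G} (f : X →[G] Y) (c : (constant G K).obj X) (y : Y) :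
    ((constant G K).tr f c).1 y = ∑ x : {x : X // f x = y}, c.1 x.1 := rfl

theorem FP_tr_apply {X Y : FinGSet G} (f : X →[G] Y) (c : (FP G L).obj X) (y : Y) :
    ((FP G L).tr f c).1 y = ∑ x : {x : X // f x = y}, c.1 x.1 := rfl

variable [Finite G]

/-- The equivariant function `(x, g) ↦ b g`. -/
noncomputable def basisFun (hb : ∀ g h, b (g * h) = g • b h) (X : FinGSet G) :
    (FP G L).obj (prodG X) :=
  ⟨fun p => b (sndG p), fun g p => (congrArg b (sndG_smul g p)).trans (hb g _)⟩

theorem res_basisFun (hb : ∀ g h, b (g * h) = g • b h) {X Y : FinGSet G} (f : X →[G] Y) :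
    (FP G L).res (mapG f) (basisFun hb Y) = basisFun hb X :=
  FP.ext fun p => congrArg b (sndG_mapG f p)

variable [SMulCommClass G K L]

/-- The coordinates of an equivariant function with respect to a normal basis. -/
noncomputable def coordFun (hb : ∀ g h, b (g * h) = g • b h) {X : FinGSet G}
    (m : (FP G L).obj X) : (constant G K).obj (prodG X) :=
  ⟨fun p => b.repr (m.1 (fstG X p)) (sndG p), fun g p =>
    (congrArg₂ (fun x h => b.repr (m.1 x) h) (map_smul (fstG X) g p) (sndG_smul g p)).trans <|
      (congrArg (fun l => b.repr l (g * sndG p)) (m.2 g _)).trans (repr_smul_mul hb _ _ _)⟩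

variable (hb : ∀ g h, b (g * h) = g • b h) {X Y : FinGSet G}

theorem coordFun_apply (m : (FP G L).obj X) (p : prodG X) :
    (coordFun hb m).1 p = b.repr (m.1 (fstG X p)) (sndG p) := rfl

theorem coordFun_add (m m' : (FP G L).obj X) :
    coordFun hb (m + m') = coordFun hb m + coordFun hb m' :=
  constant_ext fun p =>
    DFunLike.congr_fun (map_add b.repr (m.1 (fstG X p)) (m'.1 (fstG X p))) (sndG p)

theorem coordFun_smul (c : (constant G K).obj X) (m : (FP G L).obj X) :
    coordFun hb ((constantToFP G K L).app X c * m) =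
      (constant G K).res (fstG X) c * coordFun hb m :=
  constant_ext fun p => by
    change b.repr (algebraMap K L (c.1 (fstG X p)) * m.1 (fstG X p)) (sndG p) =
      c.1 (fstG X p) * b.repr (m.1 (fstG X p)) (sndG p)
    rw [← Algebra.smul_def, map_smul, Finsupp.smul_apply, smul_eq_mul]

theorem coordFun_res (f : X →[G] Y) (m : (FP G L).obj Y) :
    coordFun hb ((FP G L).res f m) = (constant G K).res (mapG f) (coordFun hb m) :=
  constant_ext fun p => by
    change b.repr (m.1 (f (fstG X p))) (sndG p) =
      b.repr (m.1 (fstG Y (mapG f p))) (sndG (mapG f p))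
    rw [fstG_mapG, sndG_mapG]

/-- Coordinates are additive, and the fibres of `f × G` match those of `f` because the square with
the projections is cartesian. -/
theorem coordFun_tr (f : X →[G] Y) (m : (FP G L).obj X) :
    coordFun hb ((FP G L).tr f m) = (constant G K).tr (mapG f) (coordFun hb m) :=
  constant_ext fun p => by
    rw [coordFun_apply, FP_tr_apply, constant_tr_apply, map_sum, Finsupp.finsetSum_apply]
    refine (Fintype.sum_bijective _ (fibre_bijective (isCartesian_mapG f) p) _ _ fun q => ?_).symm
    exact congrArg (b.repr (m.1 (fstG X q.1)))
      ((sndG_mapG f q.1).symm.trans (congrArg sndG q.2))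

/-- The coordinates of a basis vector form a Kronecker delta, here the indicator function of the
diagonal; the fibre of `diagG` has one point or none accordingly. -/
theorem coordFun_basisFun (X : FinGSet G) :
    coordFun hb (basisFun hb X) = (constant G K).tr (diagG X) 1 :=
  constant_ext fun p => by
    classical
    rw [constant_tr_apply]
    change b.repr (b (sndG (fstG _ p))) (sndG p) = ∑ x : {x // diagG X x = p}, (1 : K)
    rw [b.repr_self, Finsupp.single_apply]
    split_ifs with h
    · have : Unique {x // diagG X x = p} :=
        { default := ⟨fstG _ p, prodG_ext (by simp) (by simpa using h)⟩
          uniq := fun x => Subtype.ext ((fstG_diagG x.1).symm.trans (congrArg (fstG _) x.2)) }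
      simp
    · have : IsEmpty {x // diagG X x = p} := ⟨fun x => h (by rw [← x.2]; simp)⟩
      simp

/-- This is the expansion of `m x` in the basis, with the sum over `G` written as a transfer along
`X × G → X`. -/
theorem tr_coordFun_mul_basisFun (m : (FP G L).obj X) :
    (FP G L).tr (fstG X) ((constantToFP G K L).app _ (coordFun hb m) * basisFun hb X) = m :=
  FP.ext fun x => by
    have := Fintype.ofFinite G
    rw [FP_tr_apply, sum_fibre_fstG x fun p =>
      ((constantToFP G K L).app _ (coordFun hb m) * basisFun hb X).1 p]
    refine (Finset.sum_congr rfl fun g _ => ?_).trans (b.sum_repr (m.1 x))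
    change algebraMap K L (b.repr (m.1 (fstG X (pairG x g))) (sndG (pairG x g))) *
      b (sndG (pairG x g)) = _
    rw [fstG_pairG, sndG_pairG, Algebra.smul_def]

/-! ### The box product with `FP(L)` -/

/-- The map `(FP(L) ⊠ N)(X) → N(X × G)` given by coordinates. -/
noncomputable def boxToProd (N : Mod (constant G K)) (X : FinGSet G) :
    Box (constantToFP G K L).toMod N X →+ N.obj (prodG X) :=
  QuotientAddGroup.lift _
    (FreeAbelianGroup.lift fun s : BoxSymbol (constantToFP G K L).toMod N X =>
      N.tr (mapG s.f) (coordFun hb s.m • N.res (fstG s.A) s.n)) <| by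
    rw [AddSubgroup.closure_le]
    rintro r hr
    simp only [SetLike.mem_coe, AddMonoidHom.mem_ker]
    cases hr with
    | add_left A f m m' n =>
      have : coordFun hb (m + m' : (FP G L).obj A) = _ := coordFun_add hb m m'
      simp only [map_sub, FreeAbelianGroup.lift_apply_of]
      erw [this]
      rw [add_smul, map_add]
      abel
    | add_right A f m n n' =>
      simp only [map_sub, FreeAbelianGroup.lift_apply_of, map_add, smul_add]
      abel
    | balanced A f c m n =>
      have : coordFun hb (c • m : (constantToFP G K L).toMod.obj A) = _ := coordFun_smul hb c m
      simp only [map_sub, FreeAbelianGroup.lift_apply_of, this, N.res_smul]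
      rw [mul_comm, mul_smul, sub_self]
    -- The coordinates of `tr g m` are a transfer along `g × G`, which Frobenius reciprocity in `N`
    -- absorbs.
    | tr_left A B g f m n =>
      have h1 : coordFun hb ((constantToFP G K L).toMod.tr g m) = _ := coordFun_tr hb g m
      simp only [map_sub, FreeAbelianGroup.lift_apply_of, h1]
      rw [mapG_comp, N.tr_comp, ← N.res_comp, ← fstG_comp_mapG, N.res_comp, N.tr_smul_res, sub_self]
    -- The other side of Frobenius reciprocity, with base change along the cartesian square of `g ×
    -- G`.
    | tr_right A B g f m n =>
      have h1 : coordFun hb ((constantToFP G K L).toMod.res g m) = _ := coordFun_res hb g m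
      simp only [map_sub, FreeAbelianGroup.lift_apply_of, h1]
      rw [mapG_comp, N.tr_comp, N.tr_res_smul, N.res_tr (isCartesian_mapG g), sub_self]

theorem boxToProd_mk (N : Mod (constant G K)) {X A : FinGSet G} (f : A →[G] X)
    (m : (FP G L).obj A) (n : N.obj A) :
    boxToProd hb N X (Box.mk (constantToFP G K L).toMod N f m n) =
      N.tr (mapG f) (coordFun hb m • N.res (fstG A) n) :=
  FreeAbelianGroup.lift_apply_of _ _

/-- The inverse `N(X × G) → (FP(L) ⊠ N)(X)` of `boxToProd`. -/
noncomputable def prodToBox (N : Mod (constant G K)) (X : FinGSet G) :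
    N.obj (prodG X) →+ Box (constantToFP G K L).toMod N X :=
  AddMonoidHom.mk' (fun n => Box.mk (constantToFP G K L).toMod N (fstG X) (basisFun hb X) n)
    fun _ _ => Box.mk_add_right _ _ _ _

/-- The coordinates of `basisFun` are `tr (diagG X) 1`. Frobenius reciprocity turns multiplication
by them into restriction and then transfer along the diagonal, which cancel against the two
projections. -/
theorem boxToProd_prodToBox (N : Mod (constant G K)) (X : FinGSet G) (n : N.obj (prodG X)) :
    boxToProd hb N X (prodToBox hb N X n) = n := by
  refine (boxToProd_mk hb N _ _ n).trans ?_
  rw [coordFun_basisFun, ← N.tr_smul_res, one_smul, ← N.res_comp, fstG_comp_diagG, N.res_id,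
    ← N.tr_comp, mapG_fstG_comp_diagG, N.tr_id]

theorem prodToBox_boxToProd (N : Mod (constant G K)) (X : FinGSet G)
    (y : Box (constantToFP G K L).toMod N X) : prodToBox hb N X (boxToProd hb N X y) = y := by
  refine DFunLike.congr_fun (f := (prodToBox hb N X).comp (boxToProd hb N X))
    (g := AddMonoidHom.id _) (Box.hom_ext fun A f m n => ?_) y
  change prodToBox hb N X (boxToProd hb N X _) = Box.mk _ _ f m n
  refine (congrArg _ (boxToProd_mk hb N f m n)).trans ?_
  -- Here `z` and `z'` stand for `basisFun` over `X` and `A`. The transfer along `f × G` crosses the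
  -- tensor as a restriction, the coordinates cross by balancing, and the remaining transfer along
  -- the projection reassembles `m` from its expansion.
  have key (z : (constantToFP G K L).toMod.obj (prodG X))
      (z' : (constantToFP G K L).toMod.obj (prodG A))
      (h1 : (constantToFP G K L).toMod.res (mapG f) z = z')
      (h2 : (constantToFP G K L).toMod.tr (fstG A) (coordFun hb m • z') = m) :
      Box.mk (constantToFP G K L).toMod N (fstG X) z
        (N.tr (mapG f) (coordFun hb m • N.res (fstG A) n)) = Box.mk _ N f m n := by
    rw [Box.mk_tr_right, h1, fstG_comp_mapG, ← Box.mk_balanced, ← Box.mk_tr_left, h2]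
  exact key _ _ (res_basisFun hb f) (tr_coordFun_mul_basisFun hb m)

theorem boxToProd_bijective (N : Mod (constant G K)) (X : FinGSet G) :
    Function.Bijective (boxToProd hb N X) :=
  Function.bijective_iff_has_inverse.2
    ⟨prodToBox hb N X, prodToBox_boxToProd hb N X, boxToProd_prodToBox hb N X⟩

theorem prodToBox_bijective (N : Mod (constant G K)) (X : FinGSet G) :
    Function.Bijective (prodToBox hb N X) :=
  Function.bijective_iff_has_inverse.2
    ⟨boxToProd hb N X, boxToProd_prodToBox hb N X, prodToBox_boxToProd hb N X⟩

/-- Naturality in `N` transports exactness at level `X × G` to the box products at level `X`. -/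
theorem boxToProd_map {N N' : Mod (constant G K)} (i : ModHom N N') (X : FinGSet G)
    (y : Box (constantToFP G K L).toMod N X) :
    boxToProd hb N' X (Box.map _ i X y) = i.app _ (boxToProd hb N X y) := by
  refine DFunLike.congr_fun (f := (boxToProd hb N' X).comp (Box.map _ i X))
    (g := (i.app _).toAddMonoidHom.comp (boxToProd hb N X)) (Box.hom_ext fun A f m n => ?_) y
  change boxToProd hb N' X (Box.map (constantToFP G K L).toMod i X (Box.mk _ N f m n)) =
    i.app _ (boxToProd hb N X (Box.mk _ N f m n))
  rw [Box.map_mk]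
  refine (boxToProd_mk hb N' f m _).trans (.trans ?_ (congrArg _ (boxToProd_mk hb N f m n).symm))
  rw [i.app_tr, (i.app _).map_smul, i.app_res]

/-- Since `FP(L) ⊠ N ≅ N(- × G)`, the module `FP(L)` is flat. -/
theorem isFlat_constantToFP (hb : ∀ g h, b (g * h) = g • b h) :
    IsFlat (constantToFP G K L).toMod := by
  intro N₁ N₂ N₃ i p h X
  obtain ⟨h1, h2, h3⟩ := h (prodG X)
  refine ⟨fun x y e => ?_, fun y => ?_, fun z => ?_⟩
  · refine (boxToProd_bijective hb N₁ X).1 (h1 ?_)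
    rw [← boxToProd_map, ← boxToProd_map, e]
  · rw [← (boxToProd_bijective hb N₃ X).1.eq_iff, map_zero, boxToProd_map, h2]
    constructor
    · rintro ⟨n, hn⟩
      obtain ⟨x, rfl⟩ := (boxToProd_bijective hb N₁ X).2 n
      rw [← boxToProd_map] at hn
      exact ⟨x, (boxToProd_bijective hb N₂ X).1 hn⟩
    · rintro ⟨x, rfl⟩
      exact ⟨_, (boxToProd_map hb i X x).symm⟩
  · obtain ⟨n, hn⟩ := h3 (boxToProd hb N₃ X z)
    obtain ⟨y, rfl⟩ := (boxToProd_bijective hb N₂ X).2 n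
    rw [← boxToProd_map] at hn
    exact ⟨y, (boxToProd_bijective hb N₃ X).1 hn⟩

/-! ### Finite presentation -/

theorem isFinitelyPresented_constantToFP (hb : ∀ g h, b (g * h) = g • b h)
    (hK : SatisfiesHilbertBasis (constant G K)) : IsFinitelyPresented (constantToFP G K L) := by
  -- Under `FP(L)(G/e) = L` this is the normal basis generator `b 1`. Its restriction along `Y × G →
  -- G` is `basisFun`.
  let z : (FP G L).obj (regular G) := ⟨fun y => b ((modelEquiv G).symm y), fun g y => by
    rw [← hb, ← smul_eq_mul]
    exact congrArg b (modelEquiv_symm_smul g y)⟩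
  refine isFinitelyPresented_of_surjective _ hK (n := 1) (fun _ => regular G) (fun _ => z)
    fun Y m => ?_
  have hz : (FP G L).res (toRegular Y) z = basisFun hb Y :=
    FP.ext fun p => congrArg b ((modelEquiv G).symm_apply_apply (sndG p))
  -- The basis expansion of `m`, read as a polynomial expression in the generator.
  refine ⟨PolyObj.mk (.tr (fstG Y) (.mul (.const (coordFun hb m)) (.res (toRegular Y) (.gen 0)))),
    ?_⟩
  refine .trans ?_ (tr_coordFun_mul_basisFun hb m)
  rw [← hz]
  rfl

end NormalBasis

/-! ### The box square of `FP(L)` and its Kähler differentials -/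

/-- The ring of functions `G → L`, on which `G` acts by `(γ • h)(g) = γ • h(γ⁻¹ g γ)`. For a Galois
extension `L/K` it is `L ⊗_K L` with the diagonal action, via `a ⊗ b ↦ (g ↦ a * g • b)`. -/
def TwistedFun (G L : Type u) : Type u := G → L

namespace TwistedFun

variable {L : Type u} [CommRing L] [MulSemiringAction G L]

instance : CommRing (TwistedFun G L) := inferInstanceAs (CommRing (G → L))

instance : MulSemiringAction G (TwistedFun G L) where
  smul γ h := fun g => γ • h (γ⁻¹ * g * γ)
  one_smul h := funext fun g => by
    change (1 : G) • h (1⁻¹ * g * 1) = h g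
    simp
  mul_smul γ δ h := funext fun g => by
    change (γ * δ) • h ((γ * δ)⁻¹ * g * (γ * δ)) = γ • δ • h (δ⁻¹ * (γ⁻¹ * g * γ) * δ)
    rw [mul_smul]
    simp only [mul_inv_rev, mul_assoc]
  smul_zero γ := funext fun _ => smul_zero γ
  smul_add γ _ _ := funext fun _ => smul_add γ _ _
  smul_one γ := funext fun _ => smul_one γ
  smul_mul γ _ _ := funext fun _ => smul_mul' γ _ _

theorem smul_apply (γ : G) (h : TwistedFun G L) (g : G) :
    (γ • h) g = γ • h (γ⁻¹ * g * γ) := rfl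

variable (G L)

/-- The map `a ↦ a ⊗ 1`. -/
def inl : L →+* TwistedFun G L := Pi.constRingHom G L

/-- The map `b ↦ 1 ⊗ b`. -/
def inr : L →+* TwistedFun G L := RingHom.pi fun g => MulSemiringAction.toRingHom G L g

/-- The multiplication map. -/
def mult : TwistedFun G L →+* L := Pi.evalRingHom (fun _ : G => L) 1

theorem inl_smul (γ : G) (l : L) : inl G L (γ • l) = γ • inl G L l := rfl

/-- The identity `g * γ = γ * (γ⁻¹ * g * γ)` is the reason for the conjugation in the action on
`TwistedFun`. -/
theorem inr_smul (γ : G) (l : L) : inr G L (γ • l) = γ • inr G L l := funext fun g => by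
  change g • γ • l = γ • (γ⁻¹ * g * γ) • l
  simp only [smul_smul, mul_assoc, mul_inv_cancel_left]

theorem mult_smul (γ : G) (h : TwistedFun G L) : mult G L (γ • h) = γ • mult G L h := by
  change γ • h (γ⁻¹ * 1 * γ) = γ • h 1
  simp

open Classical in
/-- The idempotent generating the kernel of the multiplication map. -/
noncomputable def kerIdempotent : TwistedFun G L := fun g => if g = 1 then 0 else 1

-- Conjugation fixes `1`, so the idempotent is invariant and defines a constant equivariant function
-- at every level.
open Classical in
theorem smul_kerIdempotent (γ : G) : γ • kerIdempotent G L = kerIdempotent G L := funext fun g => by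
  have : γ⁻¹ * g * γ = 1 ↔ g = 1 := by
    rw [mul_eq_one_iff_eq_inv, inv_mul_eq_iff_eq_mul, mul_inv_cancel]
  change γ • (if γ⁻¹ * g * γ = 1 then (0 : L) else 1) = if g = 1 then 0 else 1
  simp only [this]
  split_ifs <;> simp

open Classical in
theorem mul_kerIdempotent {G L : Type u} [Group G] [CommRing L] {h : TwistedFun G L}
    (hh : mult G L h = 0) :
    h * kerIdempotent G L = h := funext fun g => by
  change h g * (if g = 1 then 0 else 1) = h g
  split_ifs with hg
  · rw [mul_zero, hg]
    exact hh.symm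
  · rw [mul_one]

end TwistedFun

theorem TambaraIdeal.mul_mem_gtOne {G : Type u} [Group G] {T : TambaraFunctor G}
    (I : TambaraIdeal T) {X : FinGSet G} {a c : T.obj X} (ha : a ∈ I.carrier X)
    (hc : c ∈ I.carrier X) : a * c ∈ I.gtOne.carrier X :=
  subset_span (s := ⟨X, a * c⟩) (Or.inl ⟨X, a, c, ha, hc, rfl⟩)

/-! ### The matrix of translates and the comparison with `FP(L ⊗ L)` -/

section

variable {K L : Type u} [Field K] [Field L] [Algebra K L] [MulSemiringAction G L]
  {b : Module.Basis G K L}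

/-- The translates of a normal basis form an invertible matrix. -/
theorem bijective_mulVec_normalBasis [Fintype G] [FaithfulSMul G L] [SMulCommClass G K L]
    (b : Module.Basis G K L) :
    Function.Bijective (Matrix.of fun g h : G => g⁻¹ • b h).mulVec := by
  classical
  -- Dedekind independence of characters, applied to the automorphisms `g⁻¹`, which are distinct
  -- because the action is faithful.
  have hli : LinearIndependent L fun g : G =>
      ((MulSemiringAction.toRingHom G L g⁻¹ : L →+* L) : L → L) :=
    (linearIndependent_monoidHom L L).comp
      (fun g : G => (MulSemiringAction.toRingHom G L g⁻¹ : L →* L)) fun g h e =>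
        inv_injective (eq_of_smul_eq_smul fun l : L => DFunLike.congr_fun e l)
  have hu : IsUnit (Matrix.of fun g h : G => g⁻¹ • b h) := by
    refine Matrix.vecMul_injective_iff_isUnit.1 ?_
    refine (injective_iff_map_eq_zero
      (Matrix.vecMulLinear (Matrix.of fun g h : G => g⁻¹ • b h))).2 fun c hc => ?_
    refine funext (Fintype.linearIndependent_iff.1 hli c (funext fun l => ?_))
    simp only [Finset.sum_apply, Pi.smul_apply, smul_eq_mul, Pi.zero_apply]
    change ∑ g, c g * g⁻¹ • l = 0
    -- A row relation with coefficients `c` says that this `K`-linear operator kills the basis `b`;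
    -- hence it is zero, contradicting independence unless `c = 0`.
    let F : L →ₗ[K] L := ∑ g, LinearMap.mulLeft K (c g) ∘ₗ DistribSMul.toLinearMap K L g⁻¹
    have hF (l : L) : F l = ∑ g, c g * g⁻¹ • l := by simp [F]
    have : F = 0 := b.ext fun h => (hF _).trans (congrFun hc h)
    rw [← hF, this, LinearMap.zero_apply]
  exact ⟨Matrix.mulVec_injective_iff_isUnit.2 hu, Matrix.mulVec_surjective_iff_isUnit.2 hu⟩

variable [SMulCommClass G K L]

theorem constantToFP_comm :
    (FP.map (TwistedFun.inl G L) (TwistedFun.inl_smul G L)).comp (constantToFP G K L) =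
      (FP.map (TwistedFun.inr G L) (TwistedFun.inr_smul G L)).comp (constantToFP G K L) := by
  ext X c
  exact FP.ext fun x => funext fun g => (smul_algebraMap g (c.1 x)).symm

/-- The map `FP(L)(X × G) → FP(L ⊗ L)(X)` is bijective, by the invertibility of the matrix of
translates of a normal basis. -/
theorem toAlg_prodToBox_bijective [Fintype G] [FaithfulSMul G L]
    (hb : ∀ g h, b (g * h) = g • b h) (X : FinGSet G) :
    Function.Bijective fun n : (FP G L).obj (prodG X) =>
      Box.toAlg (constantToFP G K L) _ _ constantToFP_comm X
        (prodToBox hb (constantToFP G K L).toMod X n) := by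
  set W : Matrix G G L := Matrix.of fun g h : G => g⁻¹ • b h with hW
  have hbij : Function.Bijective W.mulVec := bijective_mulVec_normalBasis b
  -- The value is `∑ h, b h * g • n (x, h)`; pulling `g` out of the sum leaves the matrix `W`
  -- applied to `n (x, -)`.
  have hval (n : (FP G L).obj (prodG X)) (x : X) (g : G) :
      (Box.toAlg (constantToFP G K L) _ _ constantToFP_comm X
        (prodToBox hb (constantToFP G K L).toMod X n)).1 x g =
      g • W.mulVec (fun h => n.1 (pairG x h)) g := by
    have h1 := Box.toAlg_mk (constantToFP G K L) _ _ constantToFP_comm (fstG X) (basisFun hb X) n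
    have h2 := congrFun (congrFun (congrArg Subtype.val h1) x) g
    refine h2.trans ?_
    have h3 := sum_fibre_fstG x fun p : prodG X =>
      ((FP.map (TwistedFun.inl G L) (TwistedFun.inl_smul G L)).app _ (basisFun hb X) *
        (FP.map (TwistedFun.inr G L) (TwistedFun.inr_smul G L)).app _ n).1 p
    refine (congrFun h3 g).trans ?_
    refine (Finset.sum_apply g Finset.univ _).trans ?_
    rw [Matrix.mulVec, dotProduct, Finset.smul_sum]
    refine Finset.sum_congr rfl fun h _ => ?_
    change b (sndG (pairG x h)) * g • n.1 (pairG x h) = g • (g⁻¹ • b h * n.1 (pairG x h))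
    rw [smul_mul', smul_inv_smul, sndG_pairG]
  constructor
  · intro n n' e
    refine FP.ext fun p => ?_
    have : (fun h => n.1 (pairG (fstG X p) h)) = fun h => n'.1 (pairG (fstG X p) h) := by
      refine hbij.1 (funext fun g => smul_left_cancel g ?_)
      rw [← hval, ← hval]
      exact congrFun (congrFun (congrArg Subtype.val e) (fstG X p)) g
    have h := congrFun this (sndG p)
    simp only [pairG_fstG_sndG] at h
    exact h
  · intro φ
    -- The preimage is found separately for each `x` by solving a linear system; its equivariance
    -- follows from uniqueness of solutions, as `g ↦ h • v x (h⁻¹ * g)` solves the system at `h •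
    -- x`.
    choose v hv using fun x => hbij.2 fun g => g⁻¹ • φ.1 x g
    have hv' (x : X) (h g : G) : v (h • x) (h * g) = h • v x g := by
      have : v (h • x) = fun g => h • v x (h⁻¹ * g) := by
        refine hbij.1 (funext fun g => ?_)
        rw [hv]
        have hφ : φ.1 (h • x) g = h • φ.1 x (h⁻¹ * g * h) := congrFun (φ.2 h x) g
        have hx := congrFun (hv x) (h⁻¹ * g * h)
        have h4 : φ.1 x (h⁻¹ * g * h) = (h⁻¹ * g * h) • W.mulVec (v x) (h⁻¹ * g * h) := by
          rw [hx, smul_inv_smul]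
        change g⁻¹ • φ.1 (h • x) g = _
        rw [hφ, h4, smul_smul, smul_smul, Matrix.mulVec, Matrix.mulVec, dotProduct, dotProduct,
          Finset.smul_sum]
        -- Reindexing by `k ↦ h * k` matches the terms through `b (h * k) = h • b k`.
        refine Fintype.sum_equiv (Equiv.mulLeft h) _ _ fun k => ?_
        simp only [hW, Matrix.of_apply, Equiv.coe_mulLeft, smul_mul', smul_smul, hb,
          inv_mul_cancel_left]
        congr 2 <;> group
      simp only [this, inv_mul_cancel_left]
    refine ⟨⟨fun p => v (fstG X p) (sndG p), fun h p => ?_⟩, FP.ext fun x => funext fun g => ?_⟩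
    · exact (congrArg₂ v (map_smul (fstG X) h p) (sndG_smul h p)).trans (hv' _ _ _)
    · refine (hval _ x g).trans ?_
      have : (fun h => v (fstG X (pairG x h)) (sndG (pairG x h))) = v x := funext fun h => by
        rw [fstG_pairG, sndG_pairG]
      change g • W.mulVec (fun h => v (fstG X (pairG x h)) (sndG (pairG x h))) g = _
      rw [this, hv, smul_inv_smul]

/-- The box square `FP(L) ⊠ FP(L) = FP(L ⊗ L)`. -/
noncomputable def boxSquareFP [Finite G] [FaithfulSMul G L]
    (hb : ∀ g h, b (g * h) = g • b h) : BoxSquare (constantToFP G K L) where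
  P := FP G (TwistedFun G L)
  inl := FP.map (TwistedFun.inl G L) (TwistedFun.inl_smul G L)
  inr := FP.map (TwistedFun.inr G L) (TwistedFun.inr_smul G L)
  comm := constantToFP_comm
  isBox X := by
    have := Fintype.ofFinite G
    exact (Function.Bijective.of_comp_iff _ (prodToBox_bijective hb _ X)).1
      (toAlg_prodToBox_bijective hb X)
  mult := FP.map (TwistedFun.mult G L) (TwistedFun.mult_smul G L)
  mult_inl := rfl
  mult_inr := by
    ext X a
    exact FP.ext fun x => one_smul G (a.1 x)

/-- An element `a` of the kernel vanishes at `1 ∈ G`, so `a = a * e` for the idempotent `e`. As `e`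
also lies in the kernel, `a` is one of the products generating `I^{>1}`. -/
theorem kaehlerVanishes_constantToFP [Finite G] [FaithfulSMul G L]
    (hb : ∀ g h, b (g * h) = g • b h) : KaehlerVanishes (constantToFP G K L) := by
  refine ⟨boxSquareFP hb, fun X => ?_⟩
  refine Submodule.Quotient.subsingleton_iff.2 (eq_top_iff.2 fun a _ => ?_)
  let e : (FP G (TwistedFun G L)).obj X :=
    ⟨fun _ => TwistedFun.kerIdempotent G L, fun g _ => (TwistedFun.smul_kerIdempotent G L g).symm⟩
  have he : (boxSquareFP hb).mult.app X e = 0 :=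
    FP.ext (A := L) fun _ => if_pos rfl
  have ha : a.1 * (show (boxSquareFP hb).P.obj X from e) = a.1 :=
    FP.ext (A := TwistedFun G L) fun x =>
      TwistedFun.mul_kerIdempotent (congrFun (congrArg Subtype.val a.2) x)
  have := (TambaraIdeal.ker (boxSquareFP hb).mult).mul_mem_gtOne a.2 he
  rw [Submodule.mem_comap]
  exact (congrArg (· ∈ (TambaraIdeal.gtOne _).carrier X) ha).mp this

end

end Tambara

theorem mainTheorem5 (G K L : Type u) [Group G] [Finite G] [Field K] [Field L] [Algebra K L]
    [MulSemiringAction G L] [IsGaloisGroup G K L] :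
    haveI : SMulCommClass G K L := IsGaloisGroup.commutes
    Tambara.IsFormallyEtale (Tambara.constantToFP G K L) ∧
      (Tambara.SatisfiesHilbertBasis (Tambara.constant G K) →
        Tambara.IsEtale (Tambara.constantToFP G K L)) := by
  have : SMulCommClass G K L := IsGaloisGroup.commutes
  have : FaithfulSMul G L := IsGaloisGroup.faithful K
  obtain ⟨b, hb⟩ := Tambara.exists_normalBasis G K L
  have h : Tambara.IsFormallyEtale (Tambara.constantToFP G K L) :=
    ⟨Tambara.kaehlerVanishes_constantToFP hb, Tambara.isFlat_constantToFP hb⟩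
  exact ⟨h, fun hK => ⟨h, Tambara.isFinitelyPresented_constantToFP hb hK⟩⟩
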